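/- Let $d \ge 1$ and let $\nu : \mathbb{R}^d \setminus \{0\} \to [0,\infty)$ be measurable with $\int_{\mathbb{R}^d} (1 \wedge |h|^2)\, \nu(h)\, dh < \infty$. Assume that $\nu$ is unimodal, i.e. $\nu$ is radial and there is $c \ge 1$ with $\nu(r) \le c\, \nu(s)$ whenever $0 < s \le r$ (where $\nu(r)$ denotes the value of $\nu$ at vectors of norm $r$), and that the measure $\nu(h)\,dh$ has support $\mathbb{R}^d$. Let $\Omega \subset \mathbb{R}^d$ be open and bounded with Lipschitz boundary. Let $$V_\nu(\Omega|\mathbb{R}^d) = \Big\{ u : \mathbb{R}^d \to \mathbb{R} \text{ measurable} : u|_\Omega \in L^2(\Omega),\ \int_\Omega \int_{\mathbb{R}^d} (u(x)-u(y))^2\, \nu(x-y)\, dy\, dx < \infty \Big\}$$ and, for $u, v \in V_\nu(\Omega|\mathbb{R}^d)$, $$\mathcal{E}(u,v) = \frac12 \iint_{(\Omega^c \times \Omega^c)^c} (u(x)-u(y))(v(x)-v(y))\, \nu(x-y)\, dx\, dy .$$ Let $\nu'$ be any of the following measures on $\mathbb{R}^d$, given by their Lebesgue densities: $$\widetilde\nu(x)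 = \int_B (1 \wedge \nu(x-y))\, dy, \qquad \overline\nu(x) = \operatorname*{ess\,inf}_{y \in B} \nu(x-y), \qquad \nu^*(x) = \nu(R(1+|x|)),$$ where $B \subset \Omega$ is any nonempty open set and $R > 1$ is any number such that $|B_R(0) \cap \Omega| > 0$. Then $(\mathcal{E}, V_\nu(\Omega|\mathbb{R}^d))$ is a regular Dirichlet form on $L^2(\mathbb{R}^d, \nu')$. That is: $\nu'$ is a Radon measure with full support; $V_\nu(\Omega|\mathbb{R}^d)$ is a dense linear subspace of $L^2(\mathbb{R}^d, \nu')$, on which $\mathcal{E}$ is a (well defined) symmetric, nonnegative definite bilinear form; $V_\nu(\Omega|\mathbb{R}^d)$ is complete with respect to $\mathcal{E}_1(u,u) = \mathcal{E}(u,u) + \|u\|^2_{L^2(\mathbb{R}^d,\nu')}$; for every $u \in V_\nu(\Omega|\mathbb{R}^d)$ the function $v = 0 \vee (u \wedge 1)$ belongs to $V_\nu(\Omega|\mathbb{R}^d)$ and $\mathcal{E}(v,v) \le \mathcal{E}(u,u)$; and $V_\nu(\Omega|\mathbb{R}^d) \cap C_c(\mathbb{R}^d)$ is dense in $V_\nu(\Omega|\mathbb{R}^d)$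 with respect to $\mathcal{E}_1$ and dense in $C_c(\mathbb{R}^d)$ with respect to the uniform norm. -/

import Mathlib

open MeasureTheory Set Filter Topology
open scoped NNReal ENNReal

noncomputable section

/-! ### Symmetric Dirichlet forms -/

/-- The quadratic form `E₁(u, u) = E(u, u) + ‖u‖²` in `L²(m)`. -/
def energyOne {X : Type*} [MeasurableSpace X] (m : Measure X)
    (E : (X → ℝ) → (X → ℝ) → ℝ) (u : X → ℝ) : ℝ :=
  E u u + ∫ x, (u x) ^ 2 ∂m

/-- `(E, D)` is a (symmetric) Dirichlet form on `L²(X, m)`. The domain `D` is given as a set of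
functions; `memLp` and `congr_ae` say that `D` and `E` descend to `m`-classes in `L²(X, m)`. -/
structure IsDirichletForm {X : Type*} [MeasurableSpace X] (m : Measure X)
    (D : Set (X → ℝ)) (E : (X → ℝ) → (X → ℝ) → ℝ) : Prop where
  memLp : ∀ u ∈ D, MemLp u 2 m
  congr_ae : ∀ u ∈ D, ∀ v : X → ℝ, v =ᵐ[m] u → v ∈ D ∧ ∀ w ∈ D, E v w = E u w
  zero_mem : (0 : X → ℝ) ∈ D
  add_mem : ∀ u ∈ D, ∀ v ∈ D, u + v ∈ D
  smul_mem : ∀ (a : ℝ), ∀ u ∈ D, a • u ∈ D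
  dense : ∀ f : X → ℝ, MemLp f 2 m → ∀ ε : ℝ, 0 < ε →
    ∃ u ∈ D, eLpNorm (f - u) 2 m < ENNReal.ofReal ε
  symm : ∀ u ∈ D, ∀ v ∈ D, E u v = E v u
  add_left : ∀ u ∈ D, ∀ v ∈ D, ∀ w ∈ D, E (u + v) w = E u w + E v w
  smul_left : ∀ (a : ℝ), ∀ u ∈ D, ∀ v ∈ D, E (a • u) v = a * E u v
  nonneg : ∀ u ∈ D, 0 ≤ E u u
  /-- closedness: `D` is complete with respect to `E₁` -/
  complete : ∀ w : ℕ → X → ℝ, (∀ n, w n ∈ D) →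
    (∀ ε : ℝ, 0 < ε → ∃ N : ℕ, ∀ i ≥ N, ∀ j ≥ N, energyOne m E (w i - w j) < ε) →
    ∃ u ∈ D, Tendsto (fun n => energyOne m E (w n - u)) atTop (𝓝 0)
  /-- Markov property: the unit contraction operates on `E` -/
  markov : ∀ u ∈ D, (fun x => max 0 (min (u x) 1)) ∈ D ∧
    E (fun x => max 0 (min (u x) 1)) (fun x => max 0 (min (u x) 1)) ≤ E u u

/-- `(E, D)` is a regular Dirichlet form on `L²(X, m)`: `m` is a Radon measure with full support,
`(E, D)` is a Dirichlet form, and `D ∩ C_c(X)` is dense in `D` with respect to `E₁` and in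
`C_c(X)` with respect to the uniform norm. -/
structure IsRegularDirichletForm {X : Type*} [TopologicalSpace X] [MeasurableSpace X]
    (m : Measure X) (D : Set (X → ℝ)) (E : (X → ℝ) → (X → ℝ) → ℝ) : Prop where
  radon : IsFiniteMeasureOnCompacts m
  full_support : m.IsOpenPosMeasure
  isDirichletForm : IsDirichletForm m D E
  core_dense : ∀ u ∈ D, ∀ ε : ℝ, 0 < ε →
    ∃ φ ∈ D, Continuous φ ∧ HasCompactSupport φ ∧ energyOne m E (u - φ) < ε
  core_uniform : ∀ f : X → ℝ, Continuous f → HasCompactSupport f → ∀ ε : ℝ, 0 < ε →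
    ∃ φ ∈ D, Continuous φ ∧ HasCompactSupport φ ∧ ∀ x, |f x - φ x| < ε

/-! ### Lévy densities

A density `ν : ℝᵈ ∖ {0} → [0, ∞)` is represented by a function on `ℝᵈ`; its value at `0` never
matters. -/

/-- A measurable density satisfying `∫ (1 ∧ |h|²) ν(h) dh < ∞`. -/
structure IsLevyDensity {d : ℕ} (ν : EuclideanSpace ℝ (Fin d) → ℝ≥0) : Prop where
  measurable : Measurable ν
  levy : ∫⁻ h, ENNReal.ofReal (min 1 (‖h‖ ^ 2)) * (ν h : ℝ≥0∞) < ∞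

/-- Unimodality: `ν` is radial (off the origin) with an almost decreasing profile. -/
structure IsUnimodal {d : ℕ} (ν : EuclideanSpace ℝ (Fin d) → ℝ≥0) : Prop where
  radial : ∀ x y, x ≠ 0 → y ≠ 0 → ‖x‖ = ‖y‖ → ν x = ν y
  almost_decreasing : ∃ c : ℝ≥0, 1 ≤ c ∧
    ∀ x y, x ≠ 0 → y ≠ 0 → ‖y‖ ≤ ‖x‖ → ν x ≤ c * ν y

/-- The measure `ν(h) dh` has topological support `ℝᵈ`. -/
def HasFullSupport {d : ℕ} (ν : EuclideanSpace ℝ (Fin d) → ℝ≥0) : Prop :=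
  (volume.withDensity fun h => (ν h : ℝ≥0∞)).IsOpenPosMeasure

/-- The profile `r ↦ ν(r)` of a radial density: its value at the vectors of norm `r > 0`. -/
def radialProfile {d : ℕ} [NeZero d] (ν : EuclideanSpace ℝ (Fin d) → ℝ≥0) (r : ℝ) : ℝ≥0 :=
  ν (EuclideanSpace.single (0 : Fin d) r)

/-! ### Lipschitz boundary -/

/-- Near each boundary point, in suitable orthonormal coordinates with last axis `e`, the set `Ω`
is the region above the graph of a Lipschitz function on the hyperplane orthogonal to `e`. -/
def HasLipschitzBoundary {d : ℕ} (Ω : Set (EuclideanSpace ℝ (Fin d))) : Prop :=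
  ∀ z ∈ frontier Ω, ∃ r : ℝ, 0 < r ∧ ∃ e : EuclideanSpace ℝ (Fin d), ‖e‖ = 1 ∧
    ∃ (K : ℝ≥0) (γ : (Submodule.span ℝ {e})ᗮ → ℝ), LipschitzWith K γ ∧
      ∀ x ∈ Metric.ball z r,
        (x ∈ Ω ↔ γ ((Submodule.span ℝ {e})ᗮ.orthogonalProjectionOnto x) < inner ℝ e x)

/-! ### The energy space, the energy form and the weights -/

/-- The energy space `V_ν(Ω|ℝᵈ)`: (Lebesgue) measurable `u : ℝᵈ → ℝ` with `u|_Ω ∈ L²(Ω)` and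
`∫_Ω ∫_{ℝᵈ} (u(x) - u(y))² ν(x - y) dy dx < ∞`. -/
def energySpace {d : ℕ} (ν : EuclideanSpace ℝ (Fin d) → ℝ≥0)
    (Ω : Set (EuclideanSpace ℝ (Fin d))) : Set (EuclideanSpace ℝ (Fin d) → ℝ) :=
  {u | AEMeasurable u volume ∧ MemLp u 2 (volume.restrict Ω) ∧
    ∫⁻ x in Ω, ∫⁻ y, ENNReal.ofReal ((u x - u y) ^ 2) * (ν (x - y) : ℝ≥0∞) < ∞}

/-- `E(u, v) = ½ ∬ (u(x) - u(y)) (v(x) - v(y)) ν(x - y) dx dy`, the integral being over the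
complement of `Ωᶜ × Ωᶜ`; the integrand is integrable for `u, v ∈ V_ν(Ω|ℝᵈ)`. -/
def energyForm {d : ℕ} (ν : EuclideanSpace ℝ (Fin d) → ℝ≥0)
    (Ω : Set (EuclideanSpace ℝ (Fin d))) (u v : EuclideanSpace ℝ (Fin d) → ℝ) : ℝ :=
  (1 / 2) * ∫ p in (Ωᶜ ×ˢ Ωᶜ)ᶜ, (u p.1 - u p.2) * (v p.1 - v p.2) * (ν (p.1 - p.2) : ℝ)
    ∂(volume.prod volume)

/-- The measure with density `ν̃(x) = ∫_B 1 ∧ ν(x - y) dy`. -/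
def nuTilde {d : ℕ} (ν : EuclideanSpace ℝ (Fin d) → ℝ≥0)
    (B : Set (EuclideanSpace ℝ (Fin d))) : Measure (EuclideanSpace ℝ (Fin d)) :=
  volume.withDensity fun x => ∫⁻ y in B, min 1 (ν (x - y) : ℝ≥0∞)

/-- The measure with density `ν̄(x) = ess inf_{y ∈ B} ν(x - y)`. -/
def nuBar {d : ℕ} (ν : EuclideanSpace ℝ (Fin d) → ℝ≥0)
    (B : Set (EuclideanSpace ℝ (Fin d))) : Measure (EuclideanSpace ℝ (Fin d)) :=
  volume.withDensity fun x => essInf (fun y => (ν (x - y) : ℝ≥0∞)) (volume.restrict B)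

/-- The measure with density `ν*(x) = ν(R (1 + |x|))`. -/
def nuStar {d : ℕ} [NeZero d] (ν : EuclideanSpace ℝ (Fin d) → ℝ≥0) (R : ℝ) :
    Measure (EuclideanSpace ℝ (Fin d)) :=
  volume.withDensity fun x => (radialProfile ν (R * (1 + ‖x‖)) : ℝ≥0∞)

end

/-! The three densities are treated at once through `IsAdmissibleWeight`: a weight `w` bounded by a
multiple of `∫_Ω 1 ∧ ν(x - y) dy` and bounded below on bounded sets. Unimodality gives the upper
bounds, and together with full support of `ν` the lower ones.

The upper bound puts the energy space into `L²(w)`: integrate `u(x)² ≤ 2 (u(x) - u(y))² + 2 u(y)²`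
against `1 ∧ ν(x - y)` over `y ∈ Ω` (`IsAdmissibleWeight.exists_lintegralSq_le`). The lower bound
recovers the `L²(Ω)` norm from the `L²(w)` norm. By symmetry of `ν` the form is comparable with
`jumpEnergy`, the integral over `Ω × ℝᵈ`. Completeness follows from Fatou along an almost everywhere
convergent subsequence; the Markov property is the pointwise contraction inequality.

For density of the core, cutoffs split `u` into finitely many pieces supported in small balls and a
remainder vanishing on a large ball (`exists_isApproximable_add_of_isCompact`). The remainder is
small by dominated convergence (`exists_tail_le`). A local piece is averaged over small shifts that
move the nearby part of `Ω` into `Ω`; the Lipschitz boundary supplies a whole ball of such shifts.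
The energy error of each shift is controlled by `L²` continuity of translations, applied both to the
piece and to the square root of its energy density (`exists_jumpEnergy_translate_sub_le`), and
Jensen's inequality passes to the average (`isApproximable_of_localized`). -/

/-! ### Elementary properties of unimodal Lévy densities -/

section LevyDensity

variable {d : ℕ} {ν : EuclideanSpace ℝ (Fin d) → ℝ≥0}

theorem IsLevyDensity.lintegral_min_one_lt_top (hν : IsLevyDensity ν) :
    ∫⁻ h, min 1 (ν h : ℝ≥0∞) < ∞ := by
  have hle : ∀ h, min 1 (ν h : ℝ≥0∞) ≤ (Metric.ball 0 1).indicator (fun _ => 1) h +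
      ENNReal.ofReal (min 1 (‖h‖ ^ 2)) * (ν h : ℝ≥0∞) := by
    intro h
    by_cases hh : ‖h‖ < 1
    · rw [indicator_of_mem (by simpa using hh)]
      exact (min_le_left _ _).trans le_self_add
    · have : 1 ≤ ‖h‖ ^ 2 := one_le_pow₀ (not_lt.1 hh)
      rw [min_eq_left this, ENNReal.ofReal_one, one_mul]
      exact (min_le_right _ _).trans le_add_self
  refine (lintegral_mono hle).trans_lt ?_
  rw [lintegral_add_left (measurable_const.indicator measurableSet_ball),
    lintegral_indicator_const measurableSet_ball, one_mul]
  exact ENNReal.add_lt_top.2 ⟨measure_ball_lt_top, hν.levy⟩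

theorem IsUnimodal.map_neg (hν : IsUnimodal ν) (x) : ν (-x) = ν x := by
  rcases eq_or_ne x 0 with rfl | hx
  · simp
  · exact hν.radial _ _ (neg_ne_zero.2 hx) hx (norm_neg x)

theorem IsUnimodal.map_sub_comm (hν : IsUnimodal ν) (x y) : ν (x - y) = ν (y - x) := by
  rw [← neg_sub, hν.map_neg]

/-- A zero at `x` would propagate by almost monotonicity to all longer vectors, a nonempty open set
of measure zero. -/
theorem IsUnimodal.ne_zero (hν : IsUnimodal ν) (hs : HasFullSupport ν) {x} (hx : x ≠ 0) :
    ν x ≠ 0 := by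
  intro h0
  obtain ⟨c, -, hc⟩ := hν.almost_decreasing
  set U : Set (EuclideanSpace ℝ (Fin d)) := {y | ‖x‖ < ‖y‖} with hU
  have hUo : IsOpen U := isOpen_lt continuous_const continuous_norm
  have hUn : U.Nonempty := ⟨(2 : ℝ) • x, by
    have := norm_pos_iff.2 hx
    simp only [hU, mem_ofPred_eq, norm_smul, Real.norm_ofNat]; linarith⟩
  refine hs.open_pos U hUo hUn ?_
  rw [withDensity_apply _ hUo.measurableSet, setLIntegral_congr_fun (g := 0) hUo.measurableSet]
  · simp
  · intro y hy
    have hy0 : y ≠ 0 := norm_pos_iff.1 ((norm_nonneg x).trans_lt hy)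
    have := hc y x hy0 hx (le_of_lt hy)
    rw [h0, mul_zero] at this
    simpa using this

variable [NeZero d]

theorem norm_single_of_nonneg {r : ℝ} (hr : 0 ≤ r) :
    ‖EuclideanSpace.single (0 : Fin d) r‖ = r := by
  simp [abs_of_nonneg hr]

theorem single_ne_zero_of_pos {r : ℝ} (hr : 0 < r) :
    EuclideanSpace.single (0 : Fin d) r ≠ 0 := by
  rw [← norm_pos_iff, norm_single_of_nonneg hr.le]; exact hr

theorem IsUnimodal.exists_radialProfile_le (hν : IsUnimodal ν) :
    ∃ c : ℝ≥0, 1 ≤ c ∧ ∀ x r, x ≠ 0 → ‖x‖ ≤ r → radialProfile ν r ≤ c * ν x := by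
  obtain ⟨c, hc1, hc⟩ := hν.almost_decreasing
  refine ⟨c, hc1, fun x r hx hr => ?_⟩
  have hr0 : 0 < r := (norm_pos_iff.2 hx).trans_le hr
  exact hc _ _ (single_ne_zero_of_pos hr0) hx (by rwa [norm_single_of_nonneg hr0.le])

theorem IsUnimodal.exists_le_of_le_norm (hν : IsUnimodal ν) {r : ℝ} (hr : 0 < r) :
    ∃ C : ℝ≥0, 1 ≤ C ∧ ∀ x, r ≤ ‖x‖ → ν x ≤ C := by
  obtain ⟨c, -, hc⟩ := hν.almost_decreasing
  refine ⟨max 1 (c * radialProfile ν r), le_max_left _ _, fun x hx => le_max_of_le_right ?_⟩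
  exact hc _ _ (norm_pos_iff.1 (hr.trans_le hx)) (single_ne_zero_of_pos hr)
    (by rwa [norm_single_of_nonneg hr.le])

theorem IsUnimodal.exists_le_of_norm_le (hν : IsUnimodal ν) (hs : HasFullSupport ν) (r : ℝ) :
    ∃ c : ℝ≥0, c ≠ 0 ∧ c ≤ 1 ∧ ∀ x, x ≠ 0 → ‖x‖ ≤ r → c ≤ ν x := by
  obtain ⟨c, hc1, hc⟩ := hν.exists_radialProfile_le
  have hc0 : 0 < c := zero_lt_one.trans_le hc1
  have hp : 0 < radialProfile ν (max r 1) :=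
    pos_iff_ne_zero.2 (hν.ne_zero hs (single_ne_zero_of_pos (by positivity)))
  -- The radius `max r 1` is positive whatever `r` is; the cap at `1` makes the constant a lower
  -- bound for `1 ∧ ν` as well.
  refine ⟨min 1 (radialProfile ν (max r 1) / c), ?_, min_le_left _ _, fun x hx hr => ?_⟩
  · have : 0 < radialProfile ν (max r 1) / c := by positivity
    exact (lt_min zero_lt_one this).ne'
  · refine (min_le_right _ _).trans ?_
    rw [div_le_iff₀ hc0, mul_comm]
    exact hc x _ hx (hr.trans (le_max_left _ _))

end LevyDensity

/-! ### Admissible weights -/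

/-- A weight is admissible for `(ν, Ω)` if it is dominated by `x ↦ ∫_Ω 1 ∧ ν(x - y) dy` and bounded
away from zero on bounded sets. -/
structure IsAdmissibleWeight {d : ℕ} (ν : EuclideanSpace ℝ (Fin d) → ℝ≥0)
    (Ω : Set (EuclideanSpace ℝ (Fin d))) (w : EuclideanSpace ℝ (Fin d) → ℝ≥0∞) : Prop where
  measurable : Measurable w
  exists_le_lintegral : ∃ C : ℝ≥0, ∀ x, w x ≤ C * ∫⁻ y in Ω, min 1 (ν (x - y) : ℝ≥0∞)
  exists_le : ∀ r : ℝ, ∃ c : ℝ≥0, c ≠ 0 ∧ ∀ x, ‖x‖ ≤ r → (c : ℝ≥0∞) ≤ w x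

section Weights

variable {d : ℕ} {ν : EuclideanSpace ℝ (Fin d) → ℝ≥0} {Ω B : Set (EuclideanSpace ℝ (Fin d))}

theorem ae_ne_point [NeZero d] (x : EuclideanSpace ℝ (Fin d))
    (μ : Measure (EuclideanSpace ℝ (Fin d))) (hμ : μ ≪ volume) : ∀ᵐ y ∂μ, x - y ≠ 0 := by
  refine hμ.ae_le ?_
  have : (volume : Measure (EuclideanSpace ℝ (Fin d))) {x} = 0 := measure_singleton x
  filter_upwards [compl_mem_ae_iff.2 this] with y hy h
  exact hy (sub_eq_zero.1 h).symm

/-- Average the pointwise bound over `y ∈ B`, whose volume is positive and finite. -/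
theorem le_mul_setLIntegral_of_ae_le (hB : IsOpen B) (hne : B.Nonempty)
    (hbd : Bornology.IsBounded B) (hBΩ : B ⊆ Ω) (w : EuclideanSpace ℝ (Fin d) → ℝ≥0∞) (C : ℝ≥0)
    (h : ∀ x, ∀ᵐ y ∂volume.restrict B, w x ≤ C * min 1 (ν (x - y) : ℝ≥0∞)) :
    ∃ C : ℝ≥0, ∀ x, w x ≤ C * ∫⁻ y in Ω, min 1 (ν (x - y) : ℝ≥0∞) := by
  have h0 : volume B ≠ 0 := (hB.measure_pos volume hne).ne'
  have h1 : volume B ≠ ∞ := hbd.measure_lt_top.ne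
  refine ⟨(volume B)⁻¹.toNNReal * C, fun x => ?_⟩
  rw [ENNReal.coe_mul, ENNReal.coe_toNNReal (ENNReal.inv_ne_top.2 h0), mul_assoc]
  have key : w x * volume B ≤ C * ∫⁻ y in Ω, min 1 (ν (x - y) : ℝ≥0∞) := by
    calc w x * volume B = ∫⁻ y in B, w x := by simp
      _ ≤ ∫⁻ y in B, C * min 1 (ν (x - y) : ℝ≥0∞) := lintegral_mono_ae (h x)
      _ = C * ∫⁻ y in B, min 1 (ν (x - y) : ℝ≥0∞) := lintegral_const_mul' _ _ ENNReal.coe_ne_top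
      _ ≤ _ := by gcongr
  rw [mul_comm, ← div_eq_mul_inv]
  exact (ENNReal.le_div_iff_mul_le (Or.inl h0) (Or.inl h1)).2 key

theorem ENNReal.le_mul_min_one {a b c C : ℝ≥0∞} (hc : 1 ≤ c) (hC : 1 ≤ C) (ha : a ≤ C)
    (hab : a ≤ c * b) : a ≤ c * C * min 1 b := by
  rcases min_choice 1 b with h | h <;> rw [h]
  · rw [mul_one]; exact ha.trans (le_mul_of_one_le_left (zero_le) hc)
  · calc a ≤ c * b := hab
      _ ≤ C * (c * b) := le_mul_of_one_le_left (zero_le) hC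
      _ = c * C * b := by ring

/-- The essential infimum exceeds `a` exactly when, for some rational `q > a`, the set of `y ∈ B`
with `ν(x - y) < q` is null. These are countably many conditions on slice measures, which are
measurable in `x`. -/
theorem measurable_essInf_sub (hν : Measurable ν) :
    Measurable fun x => essInf (fun y => (ν (x - y) : ℝ≥0∞)) (volume.restrict B) := by
  refine measurable_of_Ioi fun a => ?_
  have : (fun x => essInf (fun y => (ν (x - y) : ℝ≥0∞)) (volume.restrict B)) ⁻¹' Ioi a =
      ⋃ q ∈ {q : ℚ | a < (Real.toNNReal q : ℝ≥0∞)},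
        {x | (volume.restrict B) {y | (ν (x - y) : ℝ≥0∞) < (Real.toNNReal q : ℝ≥0∞)} = 0} := by
    ext x
    simp only [mem_preimage, mem_Ioi, mem_ofPred_eq, mem_iUnion, exists_prop]
    constructor
    · intro h
      obtain ⟨q, -, hq1, hq2⟩ := ENNReal.lt_iff_exists_rat_btwn.1 h
      refine ⟨q, hq1, ?_⟩
      have := ae_lt_of_lt_essInf hq2
      refine measure_mono_null (fun y hy => ?_) this
      simp only [mem_compl_iff, mem_ofPred_eq, not_lt] at hy ⊢
      exact hy.le
    · rintro ⟨q, hq, h⟩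
      refine hq.trans_le (le_essInf_of_ae_le _ ?_)
      refine measure_mono_null (fun y hy => ?_) h
      simpa using hy
  rw [this]
  refine MeasurableSet.biUnion (to_countable _) fun q _ => ?_
  have hm : MeasurableSet {p : EuclideanSpace ℝ (Fin d) × EuclideanSpace ℝ (Fin d) |
      (ν (p.1 - p.2) : ℝ≥0∞) < (Real.toNNReal q : ℝ≥0∞)} :=
    measurableSet_lt (by fun_prop) measurable_const
  exact measurable_measure_prodMk_left hm (measurableSet_singleton 0)

variable [NeZero d]

theorem isAdmissibleWeight_nuTilde (hν : IsLevyDensity ν) (hu : IsUnimodal ν)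
    (hs : HasFullSupport ν) (hΩ : Bornology.IsBounded Ω) (hB : IsOpen B) (hne : B.Nonempty)
    (hBΩ : B ⊆ Ω) :
    IsAdmissibleWeight ν Ω fun x => ∫⁻ y in B, min 1 (ν (x - y) : ℝ≥0∞) where
  measurable := by
    have hm := hν.measurable
    have : Measurable (fun p : EuclideanSpace ℝ (Fin d) × EuclideanSpace ℝ (Fin d) =>
        min 1 (ν (p.1 - p.2) : ℝ≥0∞)) := by fun_prop
    exact this.lintegral_prod_right'
  exists_le_lintegral := ⟨1, fun x => by
    rw [ENNReal.coe_one, one_mul]; exact lintegral_mono_set hBΩ⟩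
  exists_le := by
    intro r
    obtain ⟨M, hM⟩ := (hΩ.subset hBΩ).exists_norm_le
    obtain ⟨c, hc0, hc1, hc⟩ := hu.exists_le_of_norm_le hs (r + M)
    have h0 : volume B ≠ 0 := (hB.measure_pos volume hne).ne'
    have h1 : volume B ≠ ∞ := (hΩ.subset hBΩ).measure_lt_top.ne
    refine ⟨c * (volume B).toNNReal, mul_ne_zero hc0 (by simp [ENNReal.toNNReal_eq_zero_iff, h0, h1]),
      fun x hx => ?_⟩
    rw [ENNReal.coe_mul, ENNReal.coe_toNNReal h1]
    calc (c : ℝ≥0∞) * volume B = ∫⁻ y in B, c := by simp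
      _ ≤ _ := by
        refine lintegral_mono_ae ?_
        filter_upwards [ae_ne_point x _ Measure.restrict_le_self.absolutelyContinuous,
          ae_restrict_mem hB.measurableSet] with y hy hyB
        refine le_min (by exact_mod_cast hc1) (ENNReal.coe_le_coe.2 (hc _ hy ?_))
        exact (norm_sub_le _ _).trans (add_le_add hx (hM y hyB))

theorem isAdmissibleWeight_nuBar (hν : IsLevyDensity ν) (hu : IsUnimodal ν)
    (hs : HasFullSupport ν) (hΩ : Bornology.IsBounded Ω) (hB : IsOpen B) (hne : B.Nonempty)
    (hBΩ : B ⊆ Ω) :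
    IsAdmissibleWeight ν Ω
      fun x => essInf (fun y => (ν (x - y) : ℝ≥0∞)) (volume.restrict B) where
  measurable := measurable_essInf_sub hν.measurable
  exists_le_lintegral := by
    obtain ⟨b, hb⟩ := hne
    obtain ⟨ρ, hρ, hbρ⟩ := Metric.isOpen_iff.1 hB b hb
    obtain ⟨C, hC1, hC⟩ := hu.exists_le_of_le_norm (r := ρ / 4) (by positivity)
    -- Wherever `x` lies, a nonempty open part of `B` stays at distance more than `ρ / 4` from it,
    -- and there `ν(x - y) ≤ C`.
    have hbound : ∀ x, essInf (fun y => (ν (x - y) : ℝ≥0∞)) (volume.restrict B) ≤ C := by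
      intro x
      have hUo : IsOpen (B ∩ {y | ρ / 4 < ‖x - y‖}) :=
        hB.inter (isOpen_lt continuous_const (by fun_prop))
      have hUn : (B ∩ {y | ρ / 4 < ‖x - y‖}).Nonempty := by
        by_cases hx : ρ / 4 < ‖x - b‖
        · exact ⟨b, hb, hx⟩
        -- If `x` is within `ρ / 4` of `b`, the point `b + e` is still in `B` and at distance at
        -- least `ρ / 2` from `x`.
        · set e := EuclideanSpace.single (0 : Fin d) (3 * ρ / 4)
          have he : ‖e‖ = 3 * ρ / 4 := norm_single_of_nonneg (by positivity)
          refine ⟨b + e, hbρ ?_, ?_⟩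
          · simp only [Metric.mem_ball, dist_self_add_left, he]; linarith
          · have h2 : ‖e‖ ≤ ‖x - b‖ + ‖x - (b + e)‖ := by
              have : e = (x - b) - (x - (b + e)) := by abel
              calc ‖e‖ = ‖(x - b) - (x - (b + e))‖ := by rw [← this]
                _ ≤ _ := norm_sub_le _ _
            simp only [mem_ofPred_eq]
            linarith [not_lt.1 hx]
      have hae := ae_essInf_le (f := fun y => (ν (x - y) : ℝ≥0∞)) (μ := volume.restrict B)
      rw [ae_restrict_iff' hB.measurableSet] at hae
      have hpos := (hUo.measure_pos volume hUn).ne'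
      obtain ⟨y, hy, hyU⟩ := (hae.and_frequently (frequently_ae_mem_iff.2 hpos)).exists
      exact (hy hyU.1).trans (ENNReal.coe_le_coe.2 (hC _ (le_of_lt hyU.2)))
    refine le_mul_setLIntegral_of_ae_le hB ⟨b, hb⟩ (hΩ.subset hBΩ) hBΩ _ C fun x => ?_
    filter_upwards [ae_essInf_le (f := fun y => (ν (x - y) : ℝ≥0∞)) (μ := volume.restrict B)]
      with y hy
    have := ENNReal.le_mul_min_one (c := 1) le_rfl (by exact_mod_cast hC1) (hbound x)
      (hy.trans_eq (one_mul _).symm)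
    rwa [one_mul] at this
  exists_le := by
    intro r
    obtain ⟨M, hM⟩ := (hΩ.subset hBΩ).exists_norm_le
    obtain ⟨c, hc0, hc1, hc⟩ := hu.exists_le_of_norm_le hs (r + M)
    refine ⟨c, hc0, fun x hx => le_essInf_of_ae_le _ ?_⟩
    filter_upwards [ae_ne_point x _ Measure.restrict_le_self.absolutelyContinuous,
      ae_restrict_mem hB.measurableSet] with y hy hyB
    exact ENNReal.coe_le_coe.2 (hc _ hy ((norm_sub_le _ _).trans (add_le_add hx (hM y hyB))))

/-- For `|y| < R` one has `|x - y| ≤ R (1 + |x|)` because `R > 1`, so the profile is at most `c ν(x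
- y)`. It is also bounded, since its argument is at least `R`. -/
theorem isAdmissibleWeight_nuStar (hν : IsLevyDensity ν) (hu : IsUnimodal ν)
    (hs : HasFullSupport ν) (hΩo : IsOpen Ω) {R : ℝ} (hR : 1 < R)
    (hne : (Metric.ball 0 R ∩ Ω).Nonempty) :
    IsAdmissibleWeight ν Ω fun x => (radialProfile ν (R * (1 + ‖x‖)) : ℝ≥0∞) where
  measurable := by
    have hm := hν.measurable
    unfold radialProfile
    have : Continuous fun r : ℝ => (EuclideanSpace.single (0 : Fin d) r) :=
      (Isometry.of_dist_eq fun a b => PiLp.dist_single_same 2 (fun _ => ℝ) (0 : Fin d) a b).continuous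
    have := this.measurable
    fun_prop
  exists_le_lintegral := by
    obtain ⟨c, hc1, hc⟩ := hu.exists_radialProfile_le
    obtain ⟨C, hC1, hC⟩ := hu.exists_le_of_le_norm (r := R) (by positivity)
    refine le_mul_setLIntegral_of_ae_le (Metric.isOpen_ball.inter hΩo) hne
      (Metric.isBounded_ball.subset inter_subset_left) inter_subset_right _ (c * C) fun x => ?_
    filter_upwards [ae_ne_point x _ Measure.restrict_le_self.absolutelyContinuous,
      ae_restrict_mem (Metric.isOpen_ball.inter hΩo).measurableSet] with y hy hyB
    have hxn := norm_nonneg x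
    rw [ENNReal.coe_mul]
    refine ENNReal.le_mul_min_one (by exact_mod_cast hc1) (by exact_mod_cast hC1)
      (ENNReal.coe_le_coe.2 (hC _ ?_)) ?_
    · rw [norm_single_of_nonneg (by positivity)]; nlinarith
    · rw [← ENNReal.coe_mul]
      refine ENNReal.coe_le_coe.2 (hc _ _ hy ?_)
      have hyR : ‖y‖ < R := by simpa using hyB.1
      have := norm_sub_le x y
      nlinarith
  exists_le := by
    intro r
    obtain ⟨c, hc0, hc1, hc⟩ := hu.exists_le_of_norm_le hs (R * (1 + r))
    refine ⟨c, hc0, fun x hx => ENNReal.coe_le_coe.2 ?_⟩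
    have hpos : 0 < R * (1 + ‖x‖) := by positivity
    refine hc _ (single_ne_zero_of_pos hpos) ?_
    rw [norm_single_of_nonneg hpos.le]
    gcongr

end Weights

/-! ### Extended-valued square integrals -/

theorem ENNReal.ofReal_add_sq_le (a b : ℝ) :
    ENNReal.ofReal ((a + b) ^ 2) ≤ 2 * ENNReal.ofReal (a ^ 2) + 2 * ENNReal.ofReal (b ^ 2) := by
  have h2 : (2 : ℝ≥0∞) = ENNReal.ofReal 2 := by simp
  rw [h2, ← ENNReal.ofReal_mul zero_le_two, ← ENNReal.ofReal_mul zero_le_two,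
    ← ENNReal.ofReal_add (by positivity) (by positivity)]
  exact ENNReal.ofReal_le_ofReal (by nlinarith [sq_nonneg (a - b)])

theorem Real.enorm_sq_eq_ofReal_sq (a : ℝ) : ‖a‖ₑ ^ 2 = ENNReal.ofReal (a ^ 2) := by
  rw [Real.enorm_eq_ofReal_abs, ← ENNReal.ofReal_pow (abs_nonneg a), sq_abs]

/-- The squared `L²(m)` norm, with values in `[0, ∞]`. -/
noncomputable def lintegralSq {X : Type*} [MeasurableSpace X] (m : Measure X) (u : X → ℝ) :
    ℝ≥0∞ :=
  ∫⁻ x, ENNReal.ofReal ((u x) ^ 2) ∂m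

section LintegralSq

variable {X : Type*} [MeasurableSpace X] {m : Measure X} {u v : X → ℝ}

theorem eLpNorm_two_sq (u : X → ℝ) : eLpNorm u 2 m ^ 2 = lintegralSq m u := by
  rw [eLpNorm_eq_lintegral_rpow_enorm_toReal two_ne_zero ENNReal.ofNat_ne_top]
  simp only [ENNReal.toReal_ofNat, ENNReal.rpow_ofNat, Real.enorm_sq_eq_ofReal_sq, lintegralSq]
  rw [← ENNReal.rpow_ofNat, ← ENNReal.rpow_mul]
  norm_num

theorem memLp_two_iff_lintegralSq_lt_top (hu : AEMeasurable u m) :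
    MemLp u 2 m ↔ lintegralSq m u < ∞ := by
  rw [MemLp, ← eLpNorm_two_sq, ENNReal.pow_lt_top_iff]
  simp [hu.aestronglyMeasurable]

theorem aemeasurable_ofReal_sq (hu : AEMeasurable u m) :
    AEMeasurable (fun x => ENNReal.ofReal ((u x) ^ 2)) m := by fun_prop

theorem lintegralSq_add_le (hu : AEMeasurable u m) :
    lintegralSq m (u + v) ≤ 2 * lintegralSq m u + 2 * lintegralSq m v := by
  unfold lintegralSq
  rw [← lintegral_const_mul' _ _ ENNReal.ofNat_ne_top,
    ← lintegral_const_mul' _ _ ENNReal.ofNat_ne_top,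
    ← lintegral_add_left' ((aemeasurable_ofReal_sq hu).const_mul _)]
  exact lintegral_mono fun x => ENNReal.ofReal_add_sq_le _ _

theorem lintegralSq_smul (a : ℝ) (u : X → ℝ) :
    lintegralSq m (a • u) = ENNReal.ofReal (a ^ 2) * lintegralSq m u := by
  unfold lintegralSq
  rw [← lintegral_const_mul' _ _ ENNReal.ofReal_ne_top]
  simp only [Pi.smul_apply, smul_eq_mul, mul_pow, ENNReal.ofReal_mul (sq_nonneg a)]

theorem lintegralSq_congr_ae (h : u =ᵐ[m] v) : lintegralSq m u = lintegralSq m v :=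
  lintegral_congr_ae (h.fun_comp fun t => ENNReal.ofReal (t ^ 2))

theorem integral_sq_eq (hu : AEMeasurable u m) :
    ∫ x, (u x) ^ 2 ∂m = (lintegralSq m u).toReal :=
  integral_eq_lintegral_of_nonneg_ae (Eventually.of_forall fun _ => sq_nonneg _)
    (hu.pow_const 2).aestronglyMeasurable

end LintegralSq

/-! ### The nonlocal energy with values in `[0, ∞]` -/

section JumpEnergy

variable {d : ℕ}

/-- The integral of `(u(x) - u(y))² ν(x - y)` over `x ∈ Ω` and `y ∈ ℝᵈ`. -/
noncomputable def jumpEnergy (ν : EuclideanSpace ℝ (Fin d) → ℝ≥0)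
    (Ω : Set (EuclideanSpace ℝ (Fin d))) (u : EuclideanSpace ℝ (Fin d) → ℝ) : ℝ≥0∞ :=
  ∫⁻ p, ENNReal.ofReal ((u p.1 - u p.2) ^ 2) * (ν (p.1 - p.2) : ℝ≥0∞)
    ∂((volume.restrict Ω).prod volume)

variable {ν : EuclideanSpace ℝ (Fin d) → ℝ≥0} {Ω : Set (EuclideanSpace ℝ (Fin d))}
  {u v : EuclideanSpace ℝ (Fin d) → ℝ}

theorem restrict_prod_absolutelyContinuous (Ω : Set (EuclideanSpace ℝ (Fin d))) :
    ((volume : Measure (EuclideanSpace ℝ (Fin d))).restrict Ω).prod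
      (volume : Measure (EuclideanSpace ℝ (Fin d))) ≪ volume.prod volume :=
  Measure.restrict_le_self.absolutelyContinuous.prod Measure.AbsolutelyContinuous.rfl

theorem aemeasurable_sub_prod (hu : AEMeasurable u volume) :
    AEMeasurable (fun p : EuclideanSpace ℝ (Fin d) × EuclideanSpace ℝ (Fin d) => u p.1 - u p.2)
      (volume.prod volume) :=
  (hu.comp_quasiMeasurePreserving Measure.quasiMeasurePreserving_fst).sub
    (hu.comp_quasiMeasurePreserving Measure.quasiMeasurePreserving_snd)

theorem aemeasurable_jump (hν : Measurable ν) (hu : AEMeasurable u volume) :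
    AEMeasurable (fun p : EuclideanSpace ℝ (Fin d) × EuclideanSpace ℝ (Fin d) =>
      ENNReal.ofReal ((u p.1 - u p.2) ^ 2) * (ν (p.1 - p.2) : ℝ≥0∞)) (volume.prod volume) := by
  have h1 := aemeasurable_sub_prod hu
  have h2 : Measurable fun p : EuclideanSpace ℝ (Fin d) × EuclideanSpace ℝ (Fin d) =>
    (ν (p.1 - p.2) : ℝ≥0∞) := by fun_prop
  exact (aemeasurable_ofReal_sq h1).mul h2.aemeasurable

theorem jumpEnergy_eq_lintegral_lintegral (hν : Measurable ν) (hu : AEMeasurable u volume) :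
    jumpEnergy ν Ω u =
      ∫⁻ x in Ω, ∫⁻ y, ENNReal.ofReal ((u x - u y) ^ 2) * (ν (x - y) : ℝ≥0∞) :=
  lintegral_prod _ ((aemeasurable_jump hν hu).mono_ac (restrict_prod_absolutelyContinuous Ω))

theorem mem_energySpace_iff (hν : Measurable ν) :
    u ∈ energySpace ν Ω ↔ AEMeasurable u volume ∧ lintegralSq (volume.restrict Ω) u < ∞ ∧
      jumpEnergy ν Ω u < ∞ := by
  refine and_congr_right fun hu => ?_
  rw [memLp_two_iff_lintegralSq_lt_top hu.restrict, jumpEnergy_eq_lintegral_lintegral hν hu]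

theorem jumpEnergy_add_le (hν : Measurable ν) (hu : AEMeasurable u volume) :
    jumpEnergy ν Ω (u + v) ≤ 2 * jumpEnergy ν Ω u + 2 * jumpEnergy ν Ω v := by
  unfold jumpEnergy
  rw [← lintegral_const_mul' _ _ ENNReal.ofNat_ne_top,
    ← lintegral_const_mul' _ _ ENNReal.ofNat_ne_top,
    ← lintegral_add_left' (((aemeasurable_jump hν hu).mono_ac
      (restrict_prod_absolutelyContinuous Ω)).const_mul _)]
  refine lintegral_mono fun p => ?_
  rw [← mul_assoc, ← mul_assoc, ← add_mul]
  gcongr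
  refine le_trans (le_of_eq ?_) (ENNReal.ofReal_add_sq_le _ _)
  simp only [Pi.add_apply]
  ring_nf

theorem jumpEnergy_smul (a : ℝ) (u : EuclideanSpace ℝ (Fin d) → ℝ) :
    jumpEnergy ν Ω (a • u) = ENNReal.ofReal (a ^ 2) * jumpEnergy ν Ω u := by
  unfold jumpEnergy
  rw [← lintegral_const_mul' _ _ ENNReal.ofReal_ne_top]
  refine lintegral_congr fun p => ?_
  rw [← mul_assoc, ← ENNReal.ofReal_mul (sq_nonneg a)]
  simp only [Pi.smul_apply, smul_eq_mul]
  ring_nf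

theorem ae_prod_of_ae {p : EuclideanSpace ℝ (Fin d) → Prop} (h : ∀ᵐ x, p x) :
    ∀ᵐ q ∂((volume : Measure (EuclideanSpace ℝ (Fin d))).prod
      (volume : Measure (EuclideanSpace ℝ (Fin d)))), p q.1 ∧ p q.2 :=
  (Measure.quasiMeasurePreserving_fst.ae h).and (Measure.quasiMeasurePreserving_snd.ae h)

theorem jumpEnergy_congr_ae (h : u =ᵐ[volume] v) : jumpEnergy ν Ω u = jumpEnergy ν Ω v := by
  refine lintegral_congr_ae ((restrict_prod_absolutelyContinuous Ω).ae_le ?_)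
  filter_upwards [ae_prod_of_ae h] with q hq
  rw [hq.1, hq.2]

theorem mem_energySpace_congr_ae (hν : Measurable ν) (h : u =ᵐ[volume] v)
    (hu : u ∈ energySpace ν Ω) : v ∈ energySpace ν Ω := by
  rw [mem_energySpace_iff hν] at hu ⊢
  exact ⟨hu.1.congr h, (lintegralSq_congr_ae (ae_restrict_of_ae h)) ▸ hu.2.1,
    jumpEnergy_congr_ae h ▸ hu.2.2⟩

theorem energyForm_congr_ae (h : u =ᵐ[volume] v) (w : EuclideanSpace ℝ (Fin d) → ℝ) :
    energyForm ν Ω u w = energyForm ν Ω v w := by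
  unfold energyForm
  congr 1
  refine integral_congr_ae (ae_restrict_of_ae ?_)
  filter_upwards [ae_prod_of_ae h] with q hq
  rw [hq.1, hq.2]

theorem energySpace_add_mem (hν : Measurable ν) (hu : u ∈ energySpace ν Ω)
    (hv : v ∈ energySpace ν Ω) : u + v ∈ energySpace ν Ω := by
  rw [mem_energySpace_iff hν] at hu hv ⊢
  refine ⟨hu.1.add hv.1, (lintegralSq_add_le hu.1.restrict).trans_lt ?_,
    (jumpEnergy_add_le hν hu.1).trans_lt ?_⟩
  · exact ENNReal.add_lt_top.2 ⟨ENNReal.mul_lt_top (by simp) hu.2.1,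
      ENNReal.mul_lt_top (by simp) hv.2.1⟩
  · exact ENNReal.add_lt_top.2 ⟨ENNReal.mul_lt_top (by simp) hu.2.2,
      ENNReal.mul_lt_top (by simp) hv.2.2⟩

theorem energySpace_smul_mem (hν : Measurable ν) (a : ℝ) (hu : u ∈ energySpace ν Ω) :
    a • u ∈ energySpace ν Ω := by
  rw [mem_energySpace_iff hν] at hu ⊢
  refine ⟨hu.1.const_smul a, ?_, ?_⟩
  · rw [lintegralSq_smul]; exact ENNReal.mul_lt_top (by simp) hu.2.1
  · rw [jumpEnergy_smul]; exact ENNReal.mul_lt_top (by simp) hu.2.2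

theorem energySpace_sub_mem (hν : Measurable ν) (hu : u ∈ energySpace ν Ω)
    (hv : v ∈ energySpace ν Ω) : u - v ∈ energySpace ν Ω := by
  rw [sub_eq_add_neg, ← neg_one_smul ℝ v]
  exact energySpace_add_mem hν hu (energySpace_smul_mem hν (-1) hv)

/-! ### The bilinear form -/

theorem compl_prod_compl_compl (Ω : Set (EuclideanSpace ℝ (Fin d))) :
    (Ωᶜ ×ˢ Ωᶜ)ᶜ = Ω ×ˢ univ ∪ univ ×ˢ Ω := by
  ext p; simp only [mem_compl_iff, mem_prod, mem_union, mem_univ, and_true, true_and]; tauto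

theorem restrict_prod_univ (Ω : Set (EuclideanSpace ℝ (Fin d))) :
    ((volume : Measure (EuclideanSpace ℝ (Fin d))).prod
      (volume : Measure (EuclideanSpace ℝ (Fin d)))).restrict (Ω ×ˢ univ) =
      (volume.restrict Ω).prod volume := by
  rw [← Measure.prod_restrict, Measure.restrict_univ]

theorem jumpEnergy_le_setLIntegral (Ω : Set (EuclideanSpace ℝ (Fin d)))
    (u : EuclideanSpace ℝ (Fin d) → ℝ) :
    jumpEnergy ν Ω u ≤ ∫⁻ p in (Ωᶜ ×ˢ Ωᶜ)ᶜ,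
      ENNReal.ofReal ((u p.1 - u p.2) ^ 2) * (ν (p.1 - p.2) : ℝ≥0∞) ∂(volume.prod volume) := by
  rw [jumpEnergy, ← restrict_prod_univ, compl_prod_compl_compl]
  exact lintegral_mono_set subset_union_left

/-- The domain is the union of `Ω × ℝᵈ` and its mirror image, and the integrand is symmetric. The
overlap `Ω × Ω` is counted twice, hence only an inequality. -/
theorem setLIntegral_le_two_mul_jumpEnergy (hν : IsUnimodal ν)
    (Ω : Set (EuclideanSpace ℝ (Fin d))) (u : EuclideanSpace ℝ (Fin d) → ℝ) :
    ∫⁻ p in (Ωᶜ ×ˢ Ωᶜ)ᶜ,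
      ENNReal.ofReal ((u p.1 - u p.2) ^ 2) * (ν (p.1 - p.2) : ℝ≥0∞) ∂(volume.prod volume) ≤
    2 * jumpEnergy ν Ω u := by
  rw [compl_prod_compl_compl, two_mul]
  refine (lintegral_union_le _ _ _).trans (add_le_add ?_ ?_)
  · rw [restrict_prod_univ]; rfl
  · rw [← Measure.prod_restrict, Measure.restrict_univ, ← Measure.prod_swap]
    refine (lintegral_map_equiv (μ := (volume.restrict Ω).prod volume) _
      MeasurableEquiv.prodComm).le.trans ?_
    refine lintegral_mono fun p => ?_
    simp only [MeasurableEquiv.prodComm, MeasurableEquiv.coe_mk, Equiv.prodComm_apply,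
      Prod.fst_swap, Prod.snd_swap]
    rw [hν.map_sub_comm, ← neg_sub (u p.1), neg_sq]

theorem energyForm_self_eq (hν : Measurable ν) (Ω : Set (EuclideanSpace ℝ (Fin d)))
    (hu : AEMeasurable u volume) :
    energyForm ν Ω u u = (1 / 2) * (∫⁻ p in (Ωᶜ ×ˢ Ωᶜ)ᶜ,
      ENNReal.ofReal ((u p.1 - u p.2) ^ 2) * (ν (p.1 - p.2) : ℝ≥0∞)
        ∂(volume.prod volume)).toReal := by
  unfold energyForm
  have h1 := aemeasurable_sub_prod hu
  have h2 : Measurable fun p : EuclideanSpace ℝ (Fin d) × EuclideanSpace ℝ (Fin d) =>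
    (ν (p.1 - p.2) : ℝ) := by fun_prop
  rw [integral_eq_lintegral_of_nonneg_ae]
  · congr 2
    refine lintegral_congr fun p => ?_
    rw [← sq, ENNReal.ofReal_mul (sq_nonneg _), ENNReal.ofReal_coe_nnreal]
  · exact Eventually.of_forall fun p => mul_nonneg (mul_self_nonneg _) (NNReal.coe_nonneg _)
  · exact ((h1.mul h1).mul h2.aemeasurable).restrict.aestronglyMeasurable

theorem energyForm_self_nonneg (Ω : Set (EuclideanSpace ℝ (Fin d)))
    (u : EuclideanSpace ℝ (Fin d) → ℝ) : 0 ≤ energyForm ν Ω u u :=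
  mul_nonneg (by norm_num) (integral_nonneg fun p =>
    mul_nonneg (mul_self_nonneg _) (NNReal.coe_nonneg _))

theorem energyForm_self_le (hν : Measurable ν) (hu : IsUnimodal ν)
    (h : u ∈ energySpace ν Ω) : energyForm ν Ω u u ≤ (jumpEnergy ν Ω u).toReal := by
  have h' := (mem_energySpace_iff hν).1 h
  rw [energyForm_self_eq hν Ω h'.1]
  have := ENNReal.toReal_mono (ENNReal.mul_ne_top (by simp) h'.2.2.ne)
    (setLIntegral_le_two_mul_jumpEnergy hu Ω u)
  rw [ENNReal.toReal_mul, ENNReal.toReal_ofNat] at this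
  linarith

theorem jumpEnergy_le_ofReal_energyForm (hν : Measurable ν) (hu : IsUnimodal ν)
    (h : u ∈ energySpace ν Ω) : jumpEnergy ν Ω u ≤ ENNReal.ofReal (2 * energyForm ν Ω u u) := by
  have h' := (mem_energySpace_iff hν).1 h
  rw [energyForm_self_eq hν Ω h'.1, ← mul_assoc]
  norm_num only [one_mul]
  rw [ENNReal.ofReal_toReal]
  · exact jumpEnergy_le_setLIntegral Ω u
  -- Finiteness is essential: the real-valued form would return `0` on a divergent integral.
  · exact ((setLIntegral_le_two_mul_jumpEnergy hu Ω u).trans_lt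
      (ENNReal.mul_lt_top (by simp) h'.2.2)).ne

/-- This rests on `|ab| ≤ a² + b²`; it is what makes the Bochner integral additive and monotone on
the energy space. -/
theorem integrableOn_energyForm (hν : Measurable ν) (hun : IsUnimodal ν)
    (hu : u ∈ energySpace ν Ω) (hv : v ∈ energySpace ν Ω) :
    IntegrableOn (fun p : EuclideanSpace ℝ (Fin d) × EuclideanSpace ℝ (Fin d) =>
      (u p.1 - u p.2) * (v p.1 - v p.2) * (ν (p.1 - p.2) : ℝ)) (Ωᶜ ×ˢ Ωᶜ)ᶜ
      (volume.prod volume) := by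
  rw [mem_energySpace_iff hν] at hu hv
  have hu1 := aemeasurable_sub_prod hu.1
  have hv1 := aemeasurable_sub_prod hv.1
  have h2 : Measurable fun p : EuclideanSpace ℝ (Fin d) × EuclideanSpace ℝ (Fin d) =>
    (ν (p.1 - p.2) : ℝ) := by fun_prop
  refine ⟨((hu1.mul hv1).mul h2.aemeasurable).restrict.aestronglyMeasurable, ?_⟩
  rw [hasFiniteIntegral_iff_enorm]
  calc _ ≤ ∫⁻ p in (Ωᶜ ×ˢ Ωᶜ)ᶜ, (ENNReal.ofReal ((u p.1 - u p.2) ^ 2) * (ν (p.1 - p.2) : ℝ≥0∞) +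
        ENNReal.ofReal ((v p.1 - v p.2) ^ 2) * (ν (p.1 - p.2) : ℝ≥0∞)) ∂(volume.prod volume) := by
        refine lintegral_mono fun p => ?_
        rw [← add_mul, enorm_mul, ← ENNReal.ofReal_add (sq_nonneg _) (sq_nonneg _)]
        refine mul_le_mul' ?_ (le_of_eq ?_)
        · rw [Real.enorm_eq_ofReal_abs]
          refine ENNReal.ofReal_le_ofReal (abs_le.2 ⟨?_, ?_⟩) <;>
          nlinarith [sq_nonneg ((u p.1 - u p.2) - (v p.1 - v p.2)),
            sq_nonneg ((u p.1 - u p.2) + (v p.1 - v p.2)), sq_nonneg (u p.1 - u p.2),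
            sq_nonneg (v p.1 - v p.2)]
        · rw [Real.enorm_of_nonneg (NNReal.coe_nonneg _), ENNReal.ofReal_coe_nnreal]
    _ < ∞ := by
        rw [lintegral_add_left' (aemeasurable_jump hν hu.1).restrict]
        exact ENNReal.add_lt_top.2
          ⟨(setLIntegral_le_two_mul_jumpEnergy hun Ω u).trans_lt
            (ENNReal.mul_lt_top (by simp) hu.2.2),
          (setLIntegral_le_two_mul_jumpEnergy hun Ω v).trans_lt
            (ENNReal.mul_lt_top (by simp) hv.2.2)⟩

theorem energyForm_symm (u v : EuclideanSpace ℝ (Fin d) → ℝ) :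
    energyForm ν Ω u v = energyForm ν Ω v u := by
  unfold energyForm
  simp only [mul_comm (u _ - u _)]

theorem energyForm_add_left (hν : Measurable ν) (hun : IsUnimodal ν)
    (hu : u ∈ energySpace ν Ω) (hv : v ∈ energySpace ν Ω)
    {w : EuclideanSpace ℝ (Fin d) → ℝ} (hw : w ∈ energySpace ν Ω) :
    energyForm ν Ω (u + v) w = energyForm ν Ω u w + energyForm ν Ω v w := by
  unfold energyForm
  rw [← mul_add, ← integral_add (integrableOn_energyForm hν hun hu hw)
    (integrableOn_energyForm hν hun hv hw)]
  congr 2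
  funext p
  simp only [Pi.add_apply]
  ring

theorem energyForm_smul_left (a : ℝ) (u v : EuclideanSpace ℝ (Fin d) → ℝ) :
    energyForm ν Ω (a • u) v = a * energyForm ν Ω u v := by
  unfold energyForm
  rw [mul_left_comm, ← integral_const_mul a]
  congr 2
  funext p
  simp only [Pi.smul_apply, smul_eq_mul]
  ring

theorem abs_unitContraction_sub_le (a b : ℝ) :
    |max 0 (min a 1) - max 0 (min b 1)| ≤ |a - b| :=
  (abs_max_sub_max_le_abs _ _ _).trans' (by rw [max_comm 0, max_comm 0]) |>.trans
    (abs_min_sub_min_le_max _ _ _ _ |>.trans (by simp))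

theorem energySpace_unitContraction_mem (hν : Measurable ν) (hu : u ∈ energySpace ν Ω) :
    (fun x => max 0 (min (u x) 1)) ∈ energySpace ν Ω := by
  rw [mem_energySpace_iff hν] at hu ⊢
  refine ⟨(measurable_const.max (measurable_id.min measurable_const)).comp_aemeasurable hu.1,
    lt_of_le_of_lt (lintegral_mono fun x => ?_) hu.2.1,
    lt_of_le_of_lt (lintegral_mono fun p => ?_) hu.2.2⟩
  · refine ENNReal.ofReal_le_ofReal (sq_le_sq.2 ?_)
    simpa using abs_unitContraction_sub_le (u x) 0
  · exact mul_le_mul_left (ENNReal.ofReal_le_ofReal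
      (sq_le_sq.2 (abs_unitContraction_sub_le _ _))) _

theorem energyForm_unitContraction_le (hν : Measurable ν) (hun : IsUnimodal ν)
    (hu : u ∈ energySpace ν Ω) :
    energyForm ν Ω (fun x => max 0 (min (u x) 1)) (fun x => max 0 (min (u x) 1)) ≤
      energyForm ν Ω u u := by
  unfold energyForm
  refine mul_le_mul_of_nonneg_left (integral_mono
    (integrableOn_energyForm hν hun (energySpace_unitContraction_mem hν hu)
      (energySpace_unitContraction_mem hν hu))
    (integrableOn_energyForm hν hun hu hu) fun p => ?_) (by norm_num)
  simp only [← sq]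
  exact mul_le_mul_of_nonneg_right (sq_le_sq.2 (abs_unitContraction_sub_le _ _))
    (NNReal.coe_nonneg _)

end JumpEnergy

/-! ### The weighted norm and the energy space -/

section WeightedNorm

variable {d : ℕ} {ν : EuclideanSpace ℝ (Fin d) → ℝ≥0} {Ω : Set (EuclideanSpace ℝ (Fin d))}
  {w : EuclideanSpace ℝ (Fin d) → ℝ≥0∞} {u v : EuclideanSpace ℝ (Fin d) → ℝ}

theorem lintegralSq_withDensity (hw : Measurable w) (hu : AEMeasurable u volume) :
    lintegralSq (volume.withDensity w) u = ∫⁻ x, w x * ENNReal.ofReal ((u x) ^ 2) :=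
  lintegral_withDensity_eq_lintegral_mul₀ hw.aemeasurable (aemeasurable_ofReal_sq hu)

namespace IsAdmissibleWeight

theorem exists_le_const (hw : IsAdmissibleWeight ν Ω w) (hΩ : Bornology.IsBounded Ω) :
    ∃ C : ℝ≥0, ∀ x, w x ≤ C := by
  obtain ⟨C, hC⟩ := hw.exists_le_lintegral
  refine ⟨C * (volume Ω).toNNReal, fun x => (hC x).trans ?_⟩
  rw [ENNReal.coe_mul, ENNReal.coe_toNNReal hΩ.measure_lt_top.ne]
  gcongr
  calc ∫⁻ y in Ω, min 1 (ν (x - y) : ℝ≥0∞) ≤ ∫⁻ y in Ω, 1 := lintegral_mono fun y => min_le_left _ _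
    _ = volume Ω := by simp

theorem ne_zero (hw : IsAdmissibleWeight ν Ω w) (x) : w x ≠ 0 := by
  obtain ⟨c, hc0, hc⟩ := hw.exists_le ‖x‖
  exact ((ENNReal.coe_pos.2 (pos_iff_ne_zero.2 hc0)).trans_le (hc x le_rfl)).ne'

/-- With the trivial converse, the weighted and Lebesgue null sets agree, so both measures give the
same classes of functions. -/
theorem absolutelyContinuous (hw : IsAdmissibleWeight ν Ω w) :
    volume ≪ volume.withDensity w :=
  withDensity_absolutelyContinuous' hw.measurable.aemeasurable
    (Eventually.of_forall hw.ne_zero)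

theorem isOpenPosMeasure (hw : IsAdmissibleWeight ν Ω w) :
    (volume.withDensity w).IsOpenPosMeasure :=
  hw.absolutelyContinuous.isOpenPosMeasure

theorem isFiniteMeasureOnCompacts (hw : IsAdmissibleWeight ν Ω w) (hΩ : Bornology.IsBounded Ω) :
    IsFiniteMeasureOnCompacts (volume.withDensity w) := by
  obtain ⟨C, hC⟩ := hw.exists_le_const hΩ
  refine ⟨fun K hK => ?_⟩
  rw [withDensity_apply _ hK.measurableSet]
  calc ∫⁻ x in K, w x ≤ ∫⁻ x in K, C := lintegral_mono fun x => hC x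
    _ = C * volume K := by simp
    _ < ∞ := ENNReal.mul_lt_top ENNReal.coe_lt_top hK.measure_lt_top

theorem exists_lintegralSq_le_volume (hw : IsAdmissibleWeight ν Ω w)
    (hΩ : Bornology.IsBounded Ω) :
    ∃ C : ℝ≥0, ∀ u : EuclideanSpace ℝ (Fin d) → ℝ, AEMeasurable u volume →
      lintegralSq (volume.withDensity w) u ≤ C * lintegralSq volume u := by
  obtain ⟨C, hC⟩ := hw.exists_le_const hΩ
  refine ⟨C, fun u hu => ?_⟩
  rw [lintegralSq_withDensity hw.measurable hu, lintegralSq,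
    ← lintegral_const_mul' _ _ ENNReal.coe_ne_top]
  exact lintegral_mono fun x => mul_le_mul_left (hC x) _

/-- Applied with `S = Ω` to recover membership in `L²(Ω)`, and with `S` a ball to put locally
supported functions into unweighted `L²`. -/
theorem exists_lintegralSq_restrict_le (hw : IsAdmissibleWeight ν Ω w)
    {S : Set (EuclideanSpace ℝ (Fin d))} (hSm : MeasurableSet S) (hS : Bornology.IsBounded S) :
    ∃ C : ℝ≥0, ∀ u : EuclideanSpace ℝ (Fin d) → ℝ, AEMeasurable u volume →
      lintegralSq (volume.restrict S) u ≤ C * lintegralSq (volume.withDensity w) u := by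
  obtain ⟨r, hr⟩ := hS.exists_norm_le
  obtain ⟨c, hc0, hc⟩ := hw.exists_le r
  refine ⟨c⁻¹, fun u hu => ?_⟩
  rw [lintegralSq_withDensity hw.measurable hu, lintegralSq,
    ← lintegral_const_mul' _ _ ENNReal.coe_ne_top]
  refine (setLIntegral_mono_ae' hSm (Eventually.of_forall fun x hx => ?_)).trans
    (setLIntegral_le_lintegral S _)
  rw [← mul_assoc]
  refine le_mul_of_one_le_left zero_le ?_
  rw [ENNReal.coe_inv hc0]
  calc (1 : ℝ≥0∞) = (c : ℝ≥0∞)⁻¹ * c :=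
        (ENNReal.inv_mul_cancel (by simpa using hc0) ENNReal.coe_ne_top).symm
    _ ≤ _ := by gcongr; exact hc x (hr x hx)

/-- Exchange the integrals and compare `u(x)` with `u(y)` for `y ∈ Ω`: the difference is paid for by
the energy, and `u(y)²` carries the finite mass `Λ` of `1 ∧ ν`. -/
theorem exists_lintegralSq_le (hw : IsAdmissibleWeight ν Ω w) (hν : IsLevyDensity ν)
    (hun : IsUnimodal ν) :
    ∃ C : ℝ≥0, ∀ u : EuclideanSpace ℝ (Fin d) → ℝ, AEMeasurable u volume →
      lintegralSq (volume.withDensity w) u ≤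
        C * (jumpEnergy ν Ω u + lintegralSq (volume.restrict Ω) u) := by
  obtain ⟨C, hC⟩ := hw.exists_le_lintegral
  set Λ : ℝ≥0∞ := ∫⁻ h, min 1 (ν h : ℝ≥0∞) with hΛ
  have hΛt : Λ ≠ ∞ := hν.lintegral_min_one_lt_top.ne
  have hm := hν.measurable
  refine ⟨C * (2 * (1 + Λ.toNNReal)), fun u hu => ?_⟩
  have hk : Measurable fun h => min 1 (ν h : ℝ≥0∞) := by fun_prop
  have hU := aemeasurable_ofReal_sq hu
  calc lintegralSq (volume.withDensity w) u
      = ∫⁻ x, w x * ENNReal.ofReal ((u x) ^ 2) := lintegralSq_withDensity hw.measurable hu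
    _ ≤ ∫⁻ x, C * ∫⁻ y in Ω, min 1 (ν (x - y) : ℝ≥0∞) * ENNReal.ofReal ((u x) ^ 2) := by
        refine lintegral_mono fun x => ?_
        rw [lintegral_mul_const _ (by fun_prop), ← mul_assoc]
        exact mul_le_mul_left (hC x) _
    _ = C * ∫⁻ y in Ω, ∫⁻ x, min 1 (ν (x - y) : ℝ≥0∞) * ENNReal.ofReal ((u x) ^ 2) := by
        rw [lintegral_const_mul' _ _ ENNReal.coe_ne_top, lintegral_lintegral_swap]
        have h1 : Measurable fun p : EuclideanSpace ℝ (Fin d) × EuclideanSpace ℝ (Fin d) =>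
          min 1 (ν (p.1 - p.2) : ℝ≥0∞) := by fun_prop
        exact h1.aemeasurable.mul
          (hU.comp_quasiMeasurePreserving Measure.quasiMeasurePreserving_fst)
    _ ≤ C * ∫⁻ y in Ω, (2 * (∫⁻ x, ENNReal.ofReal ((u y - u x) ^ 2) * (ν (y - x) : ℝ≥0∞)) +
          2 * (Λ * ENNReal.ofReal ((u y) ^ 2))) := by
        gcongr with y
        calc ∫⁻ x, min 1 (ν (x - y) : ℝ≥0∞) * ENNReal.ofReal ((u x) ^ 2)
            ≤ ∫⁻ x, (2 * (ENNReal.ofReal ((u y - u x) ^ 2) * (ν (y - x) : ℝ≥0∞)) +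
                2 * (min 1 (ν (x - y) : ℝ≥0∞) * ENNReal.ofReal ((u y) ^ 2))) := by
              refine lintegral_mono fun x => ?_
              have h1 : ENNReal.ofReal ((u x) ^ 2) ≤ 2 * ENNReal.ofReal ((u y - u x) ^ 2) +
                  2 * ENNReal.ofReal ((u y) ^ 2) := by
                have := ENNReal.ofReal_add_sq_le (u x - u y) (u y)
                rwa [sub_add_cancel, ← neg_sub (u y), neg_sq] at this
              calc min 1 (ν (x - y) : ℝ≥0∞) * ENNReal.ofReal ((u x) ^ 2)
                  ≤ min 1 (ν (x - y) : ℝ≥0∞) * (2 * ENNReal.ofReal ((u y - u x) ^ 2) +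
                  2 * ENNReal.ofReal ((u y) ^ 2)) := by gcongr
                _ = 2 * (ENNReal.ofReal ((u y - u x) ^ 2) * min 1 (ν (x - y) : ℝ≥0∞)) +
                  2 * (min 1 (ν (x - y) : ℝ≥0∞) * ENNReal.ofReal ((u y) ^ 2)) := by ring
                _ ≤ _ := by
                  rw [hun.map_sub_comm x y]
                  gcongr
                  exact min_le_right _ _
          _ = 2 * (∫⁻ x, ENNReal.ofReal ((u y - u x) ^ 2) * (ν (y - x) : ℝ≥0∞)) +
                2 * (Λ * ENNReal.ofReal ((u y) ^ 2)) := by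
              rw [lintegral_add_right' _ (by fun_prop),
                lintegral_const_mul' _ _ ENNReal.ofNat_ne_top,
                lintegral_const_mul' _ _ ENNReal.ofNat_ne_top,
                lintegral_mul_const _ (by fun_prop),
                lintegral_sub_right_eq_self (fun h => min 1 (ν h : ℝ≥0∞)) y]
    _ = C * (2 * jumpEnergy ν Ω u + 2 * (Λ * lintegralSq (volume.restrict Ω) u)) := by
        rw [lintegral_add_right' _ ((hU.restrict.const_mul _).const_mul _),
          lintegral_const_mul' _ _ ENNReal.ofNat_ne_top,
          lintegral_const_mul' _ _ ENNReal.ofNat_ne_top, lintegral_const_mul' _ _ hΛt,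
          jumpEnergy_eq_lintegral_lintegral hm hu, lintegralSq]
    _ ≤ _ := by
        rw [ENNReal.coe_mul, ENNReal.coe_mul, ENNReal.coe_add, ENNReal.coe_toNNReal hΛt, mul_assoc,
          mul_assoc, ENNReal.coe_ofNat, ENNReal.coe_one, ← mul_add]
        gcongr
        refine add_le_add (le_mul_of_one_le_left zero_le le_self_add) ?_ |>.trans_eq
          (mul_add _ _ _).symm
        gcongr
        exact le_add_self

theorem lintegralSq_lt_top (hw : IsAdmissibleWeight ν Ω w) (hν : IsLevyDensity ν)
    (hun : IsUnimodal ν) (hu : u ∈ energySpace ν Ω) :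
    lintegralSq (volume.withDensity w) u < ∞ := by
  obtain ⟨C, hC⟩ := hw.exists_lintegralSq_le hν hun
  rw [mem_energySpace_iff hν.measurable] at hu
  exact (hC u hu.1).trans_lt
    (ENNReal.mul_lt_top ENNReal.coe_lt_top (ENNReal.add_lt_top.2 ⟨hu.2.2, hu.2.1⟩))

theorem memLp (hw : IsAdmissibleWeight ν Ω w) (hν : IsLevyDensity ν)
    (hun : IsUnimodal ν) (hu : u ∈ energySpace ν Ω) : MemLp u 2 (volume.withDensity w) :=
  (memLp_two_iff_lintegralSq_lt_top
    (hu.1.mono_ac (withDensity_absolutelyContinuous _ _))).2 (hw.lintegralSq_lt_top hν hun hu)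

end IsAdmissibleWeight

/-! ### Multiplication by bounded Lipschitz functions -/

/-- The increment is at most `2M` and at most `L |x - y|`; the sum of the squared constants covers
both regimes of the minimum. -/
theorem sq_sub_le_mul_min {χ : EuclideanSpace ℝ (Fin d) → ℝ} {M L : ℝ≥0}
    (hM : ∀ x, |χ x| ≤ M) (hL : LipschitzWith L χ) (x y) :
    (χ x - χ y) ^ 2 ≤ ((L : ℝ) ^ 2 + 4 * (M : ℝ) ^ 2) * min 1 (‖x - y‖ ^ 2) := by
  have h1 : |χ x - χ y| ≤ 2 * M := by
    calc |χ x - χ y| ≤ |χ x| + |χ y| := abs_sub _ _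
      _ ≤ _ := by linarith [hM x, hM y]
  have h2 : |χ x - χ y| ≤ L * ‖x - y‖ := by
    have := hL.dist_le_mul x y
    rwa [Real.dist_eq, dist_eq_norm] at this
  have h1' := sq_le_sq' (by linarith [abs_nonneg (χ x - χ y)]) h1
  have h2' := sq_le_sq' (by linarith [abs_nonneg (χ x - χ y)]) h2
  rw [sq_abs] at h1' h2'
  rcases min_choice 1 (‖x - y‖ ^ 2) with h | h <;> rw [h]
  · nlinarith [sq_nonneg (L : ℝ)]
  · nlinarith [mul_nonneg (sq_nonneg (M : ℝ)) (sq_nonneg ‖x - y‖)]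

theorem measurable_levy_integrand (hν : Measurable ν) :
    Measurable fun h : EuclideanSpace ℝ (Fin d) =>
      ENNReal.ofReal (min 1 (‖h‖ ^ 2)) * (ν h : ℝ≥0∞) := by fun_prop

theorem aemeasurable_sq_mul_levy (hν : Measurable ν) (hu : AEMeasurable u volume) :
    AEMeasurable (fun p : EuclideanSpace ℝ (Fin d) × EuclideanSpace ℝ (Fin d) =>
      ENNReal.ofReal ((u p.1) ^ 2) *
      (ENNReal.ofReal (min 1 (‖p.1 - p.2‖ ^ 2)) * (ν (p.1 - p.2) : ℝ≥0∞)))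
      ((volume.restrict Ω).prod volume) := by
  refine AEMeasurable.mul ?_
    ((measurable_levy_integrand hν).comp (measurable_fst.sub measurable_snd)).aemeasurable
  exact (aemeasurable_ofReal_sq hu).restrict.comp_quasiMeasurePreserving
    Measure.quasiMeasurePreserving_fst

theorem lintegral_sq_mul_levy (hν : IsLevyDensity ν) (hu : AEMeasurable u volume) :
    ∫⁻ p, ENNReal.ofReal ((u p.1) ^ 2) *
      (ENNReal.ofReal (min 1 (‖p.1 - p.2‖ ^ 2)) * (ν (p.1 - p.2) : ℝ≥0∞))
      ∂((volume.restrict Ω).prod volume) =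
    lintegralSq (volume.restrict Ω) u *
      ∫⁻ h, ENNReal.ofReal (min 1 (‖h‖ ^ 2)) * (ν h : ℝ≥0∞) := by
  rw [lintegral_prod _ (aemeasurable_sq_mul_levy hν.measurable hu), lintegralSq,
    ← lintegral_mul_const' _ _ hν.levy.ne]
  refine lintegral_congr fun x => ?_
  dsimp only
  rw [lintegral_const_mul' _ _ ENNReal.ofReal_ne_top,
    lintegral_sub_left_eq_self
      (fun h => ENNReal.ofReal (min 1 (‖h‖ ^ 2)) * (ν h : ℝ≥0∞)) x]

theorem energySpace_mul_mem (hν : IsLevyDensity ν) {χ : EuclideanSpace ℝ (Fin d) → ℝ}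
    {M L : ℝ≥0} (hM : ∀ x, |χ x| ≤ M) (hL : LipschitzWith L χ) (hu : u ∈ energySpace ν Ω) :
    (fun x => χ x * u x) ∈ energySpace ν Ω := by
  have hm := hν.measurable
  rw [mem_energySpace_iff hm] at hu ⊢
  obtain ⟨hum, hu2, huE⟩ := hu
  have hM2 : ∀ x, (χ x) ^ 2 ≤ (M : ℝ) ^ 2 := fun x =>
    sq_le_sq.2 (by rw [NNReal.abs_eq]; exact hM x)
  refine ⟨hL.continuous.measurable.aemeasurable.mul hum, ?_, ?_⟩
  · calc lintegralSq (volume.restrict Ω) (fun x => χ x * u x)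
        ≤ lintegralSq (volume.restrict Ω) ((M : ℝ) • u) := by
          refine lintegral_mono fun x => ENNReal.ofReal_le_ofReal ?_
          simp only [Pi.smul_apply, smul_eq_mul, mul_pow]
          exact mul_le_mul_of_nonneg_right (hM2 x) (sq_nonneg _)
      _ < ∞ := by
          rw [lintegralSq_smul]
          exact ENNReal.mul_lt_top ENNReal.ofReal_lt_top hu2
  · set K : ℝ := (L : ℝ) ^ 2 + 4 * (M : ℝ) ^ 2 with hK
    calc jumpEnergy ν Ω (fun x => χ x * u x)
        ≤ ∫⁻ p, (ENNReal.ofReal (2 * (M : ℝ) ^ 2) *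
            (ENNReal.ofReal ((u p.1 - u p.2) ^ 2) * (ν (p.1 - p.2) : ℝ≥0∞)) +
            ENNReal.ofReal (2 * K) * (ENNReal.ofReal ((u p.1) ^ 2) *
              (ENNReal.ofReal (min 1 (‖p.1 - p.2‖ ^ 2)) * (ν (p.1 - p.2) : ℝ≥0∞))))
            ∂((volume.restrict Ω).prod volume) := by
          refine lintegral_mono fun p => ?_
          obtain ⟨x, y⟩ := p
          have hKχ := sq_sub_le_mul_min hM hL x y
          have hmin : 0 ≤ min 1 (‖x - y‖ ^ 2) := le_min zero_le_one (sq_nonneg _)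
          have hK0 : 0 ≤ K := by positivity
          simp only [← mul_assoc, ← add_mul]
          refine mul_le_mul_left ?_ _
          rw [← ENNReal.ofReal_mul (by positivity), ← ENNReal.ofReal_mul (by positivity),
            ← ENNReal.ofReal_mul (by positivity),
            ← ENNReal.ofReal_add (by positivity) (by positivity)]
          refine ENNReal.ofReal_le_ofReal ?_
          -- The increment of `χ` is paired with `u x`, not `u y`: here `x ∈ Ω`, where `u` is square
          -- integrable, and integrating over `y` leaves the finite Lévy integral.
          have e : χ x * u x - χ y * u y = χ y * (u x - u y) + u x * (χ x - χ y) := by ring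
          have h3 : (χ y * (u x - u y) + u x * (χ x - χ y)) ^ 2 ≤
              2 * ((χ y) ^ 2 * (u x - u y) ^ 2) + 2 * ((u x) ^ 2 * (χ x - χ y) ^ 2) := by
            nlinarith [sq_nonneg (χ y * (u x - u y) - u x * (χ x - χ y))]
          have h4 := mul_le_mul_of_nonneg_right (hM2 y) (sq_nonneg (u x - u y))
          have h5 := mul_le_mul_of_nonneg_left hKχ (sq_nonneg (u x))
          rw [e]
          nlinarith
      _ = ENNReal.ofReal (2 * (M : ℝ) ^ 2) * jumpEnergy ν Ω u + ENNReal.ofReal (2 * K) *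
            (lintegralSq (volume.restrict Ω) u *
              ∫⁻ h, ENNReal.ofReal (min 1 (‖h‖ ^ 2)) * (ν h : ℝ≥0∞)) := by
          rw [lintegral_add_right' _ ((aemeasurable_sq_mul_levy hm hum).const_mul _),
            lintegral_const_mul' _ _ ENNReal.ofReal_ne_top,
            lintegral_const_mul' _ _ ENNReal.ofReal_ne_top, jumpEnergy,
            lintegral_sq_mul_levy hν hum]
      _ < ∞ := ENNReal.add_lt_top.2 ⟨ENNReal.mul_lt_top ENNReal.ofReal_lt_top huE,
          ENNReal.mul_lt_top ENNReal.ofReal_lt_top (ENNReal.mul_lt_top hu2 hν.levy)⟩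

theorem one_mem_energySpace (hν : IsLevyDensity ν) (hΩ : Bornology.IsBounded Ω) :
    (fun _ => 1) ∈ energySpace ν Ω := by
  rw [mem_energySpace_iff hν.measurable]
  refine ⟨aemeasurable_const, ?_, ?_⟩
  · simpa [lintegralSq] using hΩ.measure_lt_top
  · simp [jumpEnergy]

theorem zero_mem_energySpace (hν : IsLevyDensity ν) :
    (0 : EuclideanSpace ℝ (Fin d) → ℝ) ∈ energySpace ν Ω := by
  rw [mem_energySpace_iff hν.measurable]
  exact ⟨aemeasurable_const, by simp [lintegralSq], by simp [jumpEnergy]⟩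

/-- Such a `φ` is a bounded Lipschitz multiple of the constant `1`, which has zero energy and lies
in `L²(Ω)` as `Ω` is bounded. -/
theorem contDiff_mem_energySpace (hν : IsLevyDensity ν) (hΩ : Bornology.IsBounded Ω)
    {φ : EuclideanSpace ℝ (Fin d) → ℝ} (hφ : ContDiff ℝ 1 φ) (hc : HasCompactSupport φ) :
    φ ∈ energySpace ν Ω := by
  obtain ⟨L, hL⟩ := hφ.lipschitzWith_of_hasCompactSupport hc one_ne_zero
  obtain ⟨C, hC⟩ := hc.exists_bound_of_continuous hφ.continuous
  have := energySpace_mul_mem hν (M := C.toNNReal)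
    (fun x => (hC x).trans (Real.le_coe_toNNReal C)) hL (one_mem_energySpace hν hΩ)
  simpa using this

end WeightedNorm

/-! ### Completeness and the Dirichlet form axioms -/

section DirichletForm

variable {d : ℕ} {ν : EuclideanSpace ℝ (Fin d) → ℝ≥0} {Ω : Set (EuclideanSpace ℝ (Fin d))}
  {w : EuclideanSpace ℝ (Fin d) → ℝ≥0∞} {u v : EuclideanSpace ℝ (Fin d) → ℝ}

theorem energyOne_nonneg (m : Measure (EuclideanSpace ℝ (Fin d))) (u) :
    0 ≤ energyOne m (energyForm ν Ω) u :=
  add_nonneg (energyForm_self_nonneg Ω u) (integral_nonneg fun _ => sq_nonneg _)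

theorem energyOne_le_toReal (hν : IsLevyDensity ν) (hun : IsUnimodal ν)
    (hw : IsAdmissibleWeight ν Ω w) (hu : u ∈ energySpace ν Ω) :
    energyOne (volume.withDensity w) (energyForm ν Ω) u ≤
      (jumpEnergy ν Ω u + lintegralSq (volume.withDensity w) u).toReal := by
  rw [energyOne, integral_sq_eq (hu.1.mono_ac (withDensity_absolutelyContinuous _ _)),
    ENNReal.toReal_add ((mem_energySpace_iff hν.measurable).1 hu).2.2.ne
      (hw.lintegralSq_lt_top hν hun hu).ne]
  exact add_le_add_left (energyForm_self_le hν.measurable hun hu) _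

theorem energyOne_lt_of_lt_ofReal (hν : IsLevyDensity ν) (hun : IsUnimodal ν)
    (hw : IsAdmissibleWeight ν Ω w) (hu : u ∈ energySpace ν Ω) {ε : ℝ}
    (h : jumpEnergy ν Ω u + lintegralSq (volume.withDensity w) u < ENNReal.ofReal ε) :
    energyOne (volume.withDensity w) (energyForm ν Ω) u < ε := by
  refine (energyOne_le_toReal hν hun hw hu).trans_lt ?_
  rwa [← ENNReal.lt_ofReal_iff_toReal_lt h.ne_top]

theorem jumpEnergy_le_ofReal_energyOne (hν : IsLevyDensity ν) (hun : IsUnimodal ν)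
    (m : Measure (EuclideanSpace ℝ (Fin d))) (hu : u ∈ energySpace ν Ω) :
    jumpEnergy ν Ω u ≤ ENNReal.ofReal (2 * energyOne m (energyForm ν Ω) u) := by
  refine (jumpEnergy_le_ofReal_energyForm hν.measurable hun hu).trans
    (ENNReal.ofReal_le_ofReal ?_)
  rw [energyOne]
  have : 0 ≤ ∫ x, (u x) ^ 2 ∂m := integral_nonneg fun _ => sq_nonneg _
  linarith

theorem lintegralSq_le_ofReal_energyOne (hν : IsLevyDensity ν) (hun : IsUnimodal ν)
    (hw : IsAdmissibleWeight ν Ω w) (hu : u ∈ energySpace ν Ω) :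
    lintegralSq (volume.withDensity w) u ≤
      ENNReal.ofReal (energyOne (volume.withDensity w) (energyForm ν Ω) u) := by
  rw [← ENNReal.ofReal_toReal (hw.lintegralSq_lt_top hν hun hu).ne,
    ← integral_sq_eq (hu.1.mono_ac (withDensity_absolutelyContinuous _ _))]
  exact ENNReal.ofReal_le_ofReal (le_add_of_nonneg_left (energyForm_self_nonneg Ω u))

theorem lintegral_le_of_tendsto_ae {X : Type*} [MeasurableSpace X] {μ : Measure X}
    {f : ℕ → X → ℝ≥0∞} {g : X → ℝ≥0∞} (hf : ∀ n, AEMeasurable (f n) μ)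
    (h : ∀ᵐ x ∂μ, Tendsto (fun n => f n x) atTop (𝓝 (g x))) {C : ℝ≥0∞}
    (hC : ∀ᶠ n in atTop, ∫⁻ x, f n x ∂μ ≤ C) : ∫⁻ x, g x ∂μ ≤ C := by
  calc ∫⁻ x, g x ∂μ = ∫⁻ x, liminf (fun n => f n x) atTop ∂μ :=
        lintegral_congr_ae (h.mono fun x hx => hx.liminf_eq.symm)
    _ ≤ liminf (fun n => ∫⁻ x, f n x ∂μ) atTop := lintegral_liminf_le' hf
    _ ≤ C := by
      refine (liminf_le_liminf hC).trans_eq ?_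
      exact tendsto_const_nhds.liminf_eq

theorem lintegralSq_le_of_tendsto_ae {X : Type*} [MeasurableSpace X] {μ : Measure X}
    {f : ℕ → X → ℝ} {g : X → ℝ} (hf : ∀ n, AEMeasurable (f n) μ)
    (h : ∀ᵐ x ∂μ, Tendsto (fun n => f n x) atTop (𝓝 (g x))) {C : ℝ≥0∞}
    (hC : ∀ᶠ n in atTop, lintegralSq μ (f n) ≤ C) : lintegralSq μ g ≤ C :=
  lintegral_le_of_tendsto_ae (fun n => aemeasurable_ofReal_sq (hf n))
    (h.mono fun _ hx => (ENNReal.continuous_ofReal.tendsto _).comp (hx.pow 2)) hC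

theorem jumpEnergy_le_of_tendsto_ae (hν : Measurable ν)
    {f : ℕ → EuclideanSpace ℝ (Fin d) → ℝ} {g : EuclideanSpace ℝ (Fin d) → ℝ}
    (hf : ∀ n, AEMeasurable (f n) volume)
    (h : ∀ᵐ x, Tendsto (fun n => f n x) atTop (𝓝 (g x))) {C : ℝ≥0∞}
    (hC : ∀ᶠ n in atTop, jumpEnergy ν Ω (f n) ≤ C) : jumpEnergy ν Ω g ≤ C := by
  refine lintegral_le_of_tendsto_ae (fun n => (aemeasurable_jump hν (hf n)).mono_ac
    (restrict_prod_absolutelyContinuous Ω))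
    ((restrict_prod_absolutelyContinuous Ω).ae_le ((ae_prod_of_ae h).mono fun p hp => ?_)) hC
  exact ENNReal.Tendsto.mul_const
    ((ENNReal.continuous_ofReal.tendsto _).comp ((hp.1.sub hp.2).pow 2))
    (Or.inr ENNReal.coe_ne_top)

theorem exists_subseq_tendsto_ae_of_cauchy {X : Type*} [MeasurableSpace X] {m : Measure X}
    {f : ℕ → X → ℝ} (hf : ∀ n, MemLp (f n) 2 m)
    (hc : ∀ ε : ℝ, 0 < ε → ∃ N, ∀ i ≥ N, ∀ j ≥ N, lintegralSq m (f i - f j) < ENNReal.ofReal ε) :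
    ∃ g : X → ℝ, MemLp g 2 m ∧ ∃ ns : ℕ → ℕ, StrictMono ns ∧
      ∀ᵐ x ∂m, Tendsto (fun k => f (ns k) x) atTop (𝓝 (g x)) := by
  have hcs : CauchySeq fun n => (hf n).toLp (f n) := by
    refine Metric.cauchySeq_iff.2 fun ε hε => ?_
    obtain ⟨N, hN⟩ := hc (ε ^ 2) (by positivity)
    refine ⟨N, fun i hi j hj => ?_⟩
    have := hN i hi j hj
    rw [← eLpNorm_two_sq, ENNReal.ofReal_pow hε.le, ENNReal.pow_lt_pow_left_iff two_ne_zero] at this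
    rw [Lp.dist_edist, Lp.edist_toLp_toLp, ← ENNReal.lt_ofReal_iff_toReal_lt this.ne_top]
    exact this
  obtain ⟨g, hg⟩ := cauchySeq_tendsto_of_complete hcs
  obtain ⟨ns, hns, hae⟩ := (tendstoInMeasure_of_tendsto_Lp hg).exists_seq_tendsto_ae
  refine ⟨g, Lp.memLp g, ns, hns, ?_⟩
  filter_upwards [hae, ae_all_iff.2 fun n => (hf n).coeFn_toLp] with x hx hx'
  simpa only [hx'] using hx

/-- The limit is found in the complete space `L²(w)`. Fatou along an a.e. convergent subsequence
then bounds the energy and the norm of `f i - u` by the Cauchy tolerance. -/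
theorem energySpace_complete (hν : IsLevyDensity ν) (hun : IsUnimodal ν) (hΩo : IsOpen Ω)
    (hΩ : Bornology.IsBounded Ω) (hw : IsAdmissibleWeight ν Ω w)
    {f : ℕ → EuclideanSpace ℝ (Fin d) → ℝ} (hf : ∀ n, f n ∈ energySpace ν Ω)
    (hc : ∀ ε : ℝ, 0 < ε → ∃ N : ℕ, ∀ i ≥ N, ∀ j ≥ N,
      energyOne (volume.withDensity w) (energyForm ν Ω) (f i - f j) < ε) :
    ∃ u ∈ energySpace ν Ω, Tendsto
      (fun n => energyOne (volume.withDensity w) (energyForm ν Ω) (f n - u)) atTop (𝓝 0) := by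
  have hm := hν.measurable
  have hsub := fun i j => energySpace_sub_mem hm (hf i) (hf j)
  have hac : volume.withDensity w ≪ volume := withDensity_absolutelyContinuous _ _
  obtain ⟨u, hu, ns, hns, hae⟩ := exists_subseq_tendsto_ae_of_cauchy
    (fun n => hw.memLp hν hun (hf n)) (fun ε hε => by
      obtain ⟨N, hN⟩ := hc ε hε
      exact ⟨N, fun i hi j hj => (lintegralSq_le_ofReal_energyOne hν hun hw (hsub i j)).trans_lt
        ((ENNReal.ofReal_lt_ofReal_iff hε).2 (hN i hi j hj))⟩)
  have hae' : ∀ᵐ x, Tendsto (fun k => f (ns k) x) atTop (𝓝 (u x)) :=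
    hw.absolutelyContinuous.ae_le hae
  have hum : AEMeasurable u volume := hu.1.aemeasurable.mono_ac hw.absolutelyContinuous
  have key : ∀ ε : ℝ, 0 < ε → ∃ N : ℕ, ∀ i ≥ N, jumpEnergy ν Ω (f i - u) ≤ ENNReal.ofReal ε ∧
      lintegralSq (volume.withDensity w) (f i - u) ≤ ENNReal.ofReal ε := by
    intro ε hε
    -- Halved because `jumpEnergy` is bounded by twice `energyOne`.
    obtain ⟨N, hN⟩ := hc (ε / 2) (by positivity)
    have hev : ∀ᶠ k in atTop, N ≤ ns k := hns.tendsto_atTop.eventually_ge_atTop N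
    refine ⟨N, fun i hi => ⟨?_, ?_⟩⟩
    · refine jumpEnergy_le_of_tendsto_ae (f := fun k => f i - f (ns k)) hm
        (fun k => (hsub i (ns k)).1) ?_ ?_
      · filter_upwards [hae'] with x hx using tendsto_const_nhds.sub hx
      · filter_upwards [hev] with k hk
        refine (jumpEnergy_le_ofReal_energyOne hν hun (volume.withDensity w) (hsub i (ns k))).trans
          (ENNReal.ofReal_le_ofReal ?_)
        linarith [hN i hi (ns k) hk]
    · refine lintegralSq_le_of_tendsto_ae (f := fun k => f i - f (ns k))
        (fun k => (hsub i (ns k)).1.mono_ac hac) ?_ ?_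
      · filter_upwards [hae] with x hx using tendsto_const_nhds.sub hx
      · filter_upwards [hev] with k hk
        refine (lintegralSq_le_ofReal_energyOne hν hun hw (hsub i (ns k))).trans
          (ENNReal.ofReal_le_ofReal ?_)
        linarith [hN i hi (ns k) hk]
  have huV : u ∈ energySpace ν Ω := by
    obtain ⟨N, hN⟩ := key 1 one_pos
    obtain ⟨C, hC⟩ := hw.exists_lintegralSq_restrict_le hΩo.measurableSet hΩ
    -- Then `u = f N - (f N - u)` is in the space by linearity.
    have hmem : f N - u ∈ energySpace ν Ω := by
      rw [mem_energySpace_iff hm]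
      refine ⟨(hf N).1.sub hum, (hC _ ((hf N).1.sub hum)).trans_lt
        (ENNReal.mul_lt_top ENNReal.coe_lt_top ?_), ?_⟩
      · exact (hN N le_rfl).2.trans_lt ENNReal.ofReal_lt_top
      · exact (hN N le_rfl).1.trans_lt ENNReal.ofReal_lt_top
    have := energySpace_sub_mem hm (hf N) hmem
    rwa [sub_sub_cancel] at this
  refine ⟨u, huV, Metric.tendsto_atTop.2 fun ε hε => ?_⟩
  obtain ⟨N, hN⟩ := key (ε / 4) (by positivity)
  refine ⟨N, fun i hi => ?_⟩
  rw [Real.dist_0_eq_abs, abs_of_nonneg (energyOne_nonneg _ _)]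
  refine energyOne_lt_of_lt_ofReal hν hun hw (energySpace_sub_mem hm (hf i) huV) ?_
  refine (add_le_add (hN i hi).1 (hN i hi).2).trans_lt ?_
  rw [← ENNReal.ofReal_add (by positivity) (by positivity)]
  exact (ENNReal.ofReal_lt_ofReal_iff hε).2 (by linarith)

theorem isDirichletForm_energyForm (hν : IsLevyDensity ν) (hun : IsUnimodal ν) (hΩo : IsOpen Ω)
    (hΩ : Bornology.IsBounded Ω) (hw : IsAdmissibleWeight ν Ω w) :
    IsDirichletForm (volume.withDensity w) (energySpace ν Ω) (energyForm ν Ω) where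
  memLp u hu := hw.memLp hν hun hu
  congr_ae u hu v hv := by
    have h : v =ᵐ[volume] u := hw.absolutelyContinuous.ae_le hv
    exact ⟨mem_energySpace_congr_ae hν.measurable h.symm hu, fun z _ => energyForm_congr_ae h z⟩
  zero_mem := zero_mem_energySpace hν
  add_mem u hu v hv := energySpace_add_mem hν.measurable hu hv
  smul_mem a u hu := energySpace_smul_mem hν.measurable a hu
  dense f hf ε hε := by
    have := hw.isFiniteMeasureOnCompacts hΩ
    obtain ⟨g, hgc, hg, hle⟩ := hf.exist_eLpNorm_sub_le (by simp) (by norm_num) (half_pos hε)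
    exact ⟨g, contDiff_mem_energySpace hν hΩ (hg.of_le (by exact_mod_cast le_top)) hgc,
      hle.trans_lt ((ENNReal.ofReal_lt_ofReal_iff hε).2 (half_lt_self hε))⟩
  symm u _ v _ := energyForm_symm u v
  add_left u hu v hv z hz := energyForm_add_left hν.measurable hun hu hv hz
  smul_left a u _ v _ := energyForm_smul_left a u v
  nonneg u _ := energyForm_self_nonneg Ω u
  complete f hf hc := energySpace_complete hν hun hΩo hΩ hw hf hc
  markov u hu := ⟨energySpace_unitContraction_mem hν.measurable hu,
    energyForm_unitContraction_le hν.measurable hun hu⟩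

theorem exists_smooth_uniform_approx (hν : IsLevyDensity ν) (hΩ : Bornology.IsBounded Ω)
    {f : EuclideanSpace ℝ (Fin d) → ℝ} (hf : Continuous f) (hc : HasCompactSupport f) {ε : ℝ}
    (hε : 0 < ε) :
    ∃ φ ∈ energySpace ν Ω, Continuous φ ∧ HasCompactSupport φ ∧ ∀ x, |f x - φ x| < ε := by
  obtain ⟨g, hg, hgd, hgs⟩ := hf.exists_contDiff_approx 1 (ε := fun _ => ε) continuous_const
    (fun _ => hε)
  have hgc : HasCompactSupport g := hc.mono hgs
  refine ⟨g, contDiff_mem_energySpace hν hΩ (by simpa using hg) hgc, hg.continuous, hgc,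
    fun x => ?_⟩
  rw [abs_sub_comm, ← Real.dist_eq]
  exact hgd x

end DirichletForm

/-! ### Inward shifts near every point of a Lipschitz domain -/

/-- Near `z`, arbitrarily small shifts (filling a small ball) map `Ω` into itself. -/
def HasInwardShifts {d : ℕ} (Ω : Set (EuclideanSpace ℝ (Fin d)))
    (z : EuclideanSpace ℝ (Fin d)) (r : ℝ) : Prop :=
  ∀ δ : ℝ, 0 < δ → ∃ a : EuclideanSpace ℝ (Fin d), ∃ s : ℝ, 0 < s ∧
    Metric.ball a s ⊆ Metric.ball 0 δ ∧ ∀ τ ∈ Metric.ball a s, ∀ x ∈ Ω ∩ Metric.ball z r, x + τ ∈ Ω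

section InwardShifts

variable {d : ℕ} {Ω : Set (EuclideanSpace ℝ (Fin d))}

/-- A shift by `(K + 1) s e + σ` with `|σ| < s` raises the height by at least `(K + 1) s - |σ|`,
while the graph rises by at most `K |σ|`; points above the graph stay above it. -/
theorem HasLipschitzBoundary.exists_hasInwardShifts_of_mem_frontier
    (hΩ : HasLipschitzBoundary Ω) {z : EuclideanSpace ℝ (Fin d)} (hz : z ∈ frontier Ω) :
    ∃ r, 0 < r ∧ HasInwardShifts Ω z r := by
  obtain ⟨r, hr, e, he, K, γ, hγ, h⟩ := hΩ z hz
  refine ⟨r / 2, by positivity, fun δ hδ => ?_⟩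
  set P := (Submodule.span ℝ {e})ᗮ.orthogonalProjectionOnto with hP
  have hPe : P e = 0 := by
    rw [hP, Submodule.orthogonalProjectionOnto_eq_zero_iff, Submodule.orthogonal_orthogonal]
    exact Submodule.mem_span_singleton_self e
  -- The shifts have length below `(K + 2) s`, so they are shorter than `δ` and keep the half-radius
  -- ball inside the chart.
  set s : ℝ := min δ (r / 2) / (K + 2) with hs
  have hK : (0 : ℝ) ≤ K := K.2
  have hs0 : 0 < s := by positivity
  have hsK : (K + 2) * s = min δ (r / 2) := by rw [hs]; field_simp
  have hnorm : ∀ τ ∈ Metric.ball (((K + 1) * s) • e) s, ‖τ‖ < min δ (r / 2) := by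
    intro τ hτ
    rw [mem_ball_iff_norm] at hτ
    calc ‖τ‖ = ‖(τ - ((K + 1) * s) • e) + ((K + 1) * s) • e‖ := by rw [sub_add_cancel]
      _ ≤ ‖τ - ((K + 1) * s) • e‖ + ‖((K + 1) * s) • e‖ := norm_add_le _ _
      _ < s + (K + 1) * s := by
        rw [norm_smul, he, mul_one, Real.norm_of_nonneg (by positivity)]; linarith
      _ = _ := by rw [← hsK]; ring
  refine ⟨((K + 1) * s) • e, s, hs0, fun τ hτ => ?_, fun τ hτ x hx => ?_⟩
  · rw [mem_ball_zero_iff]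
    exact (hnorm τ hτ).trans_le (min_le_left _ _)
  · have hτr := (hnorm τ hτ).trans_le (min_le_right _ _)
    have hxr : dist x z < r / 2 := hx.2
    have hxτ : x + τ ∈ Metric.ball z r := by
      rw [mem_ball_iff_norm]
      rw [dist_eq_norm] at hxr
      calc ‖x + τ - z‖ = ‖(x - z) + τ‖ := by congr 1; abel
        _ ≤ ‖x - z‖ + ‖τ‖ := norm_add_le _ _
        _ < r := by linarith
    rw [h _ hxτ]
    have hxγ := (h x (Metric.ball_subset_ball (by linarith) hx.2)).1 hx.1
    set σ := τ - ((K + 1) * s) • e with hσ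
    have hτσ : τ = σ + ((K + 1) * s) • e := by rw [hσ, sub_add_cancel]
    have hσs : ‖σ‖ < s := by rwa [mem_ball_iff_norm] at hτ
    have hPτ : P (x + τ) = P x + P σ := by
      rw [hτσ, map_add, map_add, map_smul, hPe, smul_zero, add_zero]
    have h1 : γ (P (x + τ)) ≤ γ (P x) + K * ‖σ‖ := by
      have h2 := hγ.dist_le_mul (P (x + τ)) (P x)
      rw [hPτ, dist_self_add_left, Real.dist_eq] at h2
      have h3 : ‖P σ‖ ≤ ‖σ‖ := Submodule.norm_orthogonalProjectionOnto_apply_le _ _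
      rw [hPτ]
      have := (le_abs_self _).trans h2
      nlinarith
    have h4 : inner ℝ e (x + τ) = inner ℝ e x + (inner ℝ e σ + (K + 1) * s) := by
      rw [hτσ, inner_add_right, inner_add_right, inner_smul_right, real_inner_self_eq_norm_sq, he]
      ring
    have h5 : -‖σ‖ ≤ inner ℝ e σ := by
      have := abs_real_inner_le_norm e σ
      rw [he, one_mul] at this
      exact (abs_le.1 this).1
    rw [h4]
    nlinarith

/-- At interior points every small shift works, and off the closure the condition is vacuous; only
the boundary needs the graph. -/
theorem HasLipschitzBoundary.exists_hasInwardShifts (hΩ : HasLipschitzBoundary Ω)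
    (hΩo : IsOpen Ω) (z : EuclideanSpace ℝ (Fin d)) : ∃ r, 0 < r ∧ HasInwardShifts Ω z r := by
  by_cases hz : z ∈ Ω
  · obtain ⟨ρ, hρ, hb⟩ := Metric.isOpen_iff.1 hΩo z hz
    refine ⟨ρ / 2, by positivity, fun δ hδ => ⟨0, min δ (ρ / 2), by positivity,
      Metric.ball_subset_ball (min_le_left _ _), fun τ hτ x hx => hb ?_⟩⟩
    rw [mem_ball_zero_iff] at hτ
    have h2 := hx.2
    rw [mem_ball_iff_norm] at h2 ⊢
    calc ‖x + τ - z‖ = ‖(x - z) + τ‖ := by congr 1; abel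
      _ ≤ ‖x - z‖ + ‖τ‖ := norm_add_le _ _
      _ < ρ := by linarith [hτ.trans_le (min_le_right _ _)]
  by_cases hz' : z ∈ closure Ω
  · refine hΩ.exists_hasInwardShifts_of_mem_frontier ?_
    rw [frontier, hΩo.interior_eq]
    exact ⟨hz', hz⟩
  · obtain ⟨r, hr, hb⟩ := Metric.isOpen_iff.1 isClosed_closure.isOpen_compl z hz'
    exact ⟨r, hr, fun δ hδ => ⟨0, δ, hδ, subset_rfl, fun τ _ x hx =>
      absurd (subset_closure hx.1) (hb hx.2)⟩⟩

end InwardShifts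

/-! ### Continuity of translations and convolution estimates -/

theorem tendsto_lintegralSq_translate {X : Type*} [NormedAddCommGroup X] [MeasurableSpace X]
    [BorelSpace X] [LocallyCompactSpace X] [SecondCountableTopology X] (μ : Measure X)
    [μ.IsAddRightInvariant] [μ.InnerRegularCompactLTTop] [IsLocallyFiniteMeasure μ]
    {G : X → ℝ} (hG : MemLp G 2 μ) :
    Tendsto (fun τ => lintegralSq μ (fun x => G (x + τ) - G x)) (𝓝 0) (𝓝 0) := by
  -- Currying makes translation a continuous family of measure-preserving maps, whose composition
  -- action on `L²` is continuous.
  let g : C(X, C(X, X)) := (ContinuousMap.mk (fun a : X × X => a.2 + a.1) (by fun_prop)).curry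
  have hg : ∀ τ, ⇑(g τ) = fun x => x + τ := fun τ => rfl
  have hmp : ∀ τ : X, MeasurePreserving (g τ) μ μ :=
    fun τ => measurePreserving_add_right μ τ
  have hcont : Continuous fun τ => Lp.compMeasurePreserving (g τ) (hmp τ) (hG.toLp G) :=
    continuous_const.compMeasurePreservingLp g.continuous hmp (by simp)
  have ht := (hcont.tendsto 0).edist (tendsto_const_nhds (x := Lp.compMeasurePreserving (g 0)
    (hmp 0) (hG.toLp G)))
  rw [edist_self] at ht
  have ht2 := (ENNReal.continuous_pow 2).tendsto 0 |>.comp ht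
  simp only [ne_eq, OfNat.ofNat_ne_zero, not_false_eq_true, zero_pow] at ht2
  refine ht2.congr fun τ => ?_
  simp only [Function.comp_apply]
  rw [Lp.toLp_compMeasurePreserving, Lp.toLp_compMeasurePreserving, Lp.edist_toLp_toLp,
    eLpNorm_two_sq]
  simp [lintegralSq, hg]

theorem ofReal_integral_sq_le {X : Type*} [MeasurableSpace X] {ρ : Measure X}
    [IsProbabilityMeasure ρ] {h : X → ℝ} (hh : AEStronglyMeasurable h ρ) :
    ENNReal.ofReal ((∫ t, h t ∂ρ) ^ 2) ≤ ∫⁻ t, ENNReal.ofReal ((h t) ^ 2) ∂ρ := by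
  rw [← Real.enorm_sq_eq_ofReal_sq]
  calc ‖∫ t, h t ∂ρ‖ₑ ^ 2 ≤ (eLpNorm h 2 ρ) ^ 2 := by
        gcongr
        refine (enorm_integral_le_lintegral_enorm h).trans ?_
        rw [← eLpNorm_one_eq_lintegral_enorm]
        exact eLpNorm_le_eLpNorm_of_exponent_le one_le_two hh
    _ = _ := eLpNorm_two_sq h

theorem tendsto_setLIntegral_superlevel {X : Type*} [MeasurableSpace X] {μ : Measure X}
    {f : X → ℝ≥0∞} (hf : AEMeasurable f μ) (hfi : ∫⁻ x, f x ∂μ ≠ ∞) {g : X → ℝ}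
    (hg : Measurable g) :
    Tendsto (fun n : ℕ => ∫⁻ x in {x | (n : ℝ) < g x}, f x ∂μ) atTop (𝓝 0) := by
  have hS : ∀ n : ℕ, MeasurableSet {x | (n : ℝ) < g x} := fun n =>
    measurableSet_lt measurable_const hg
  simp_rw [← lintegral_indicator (hS _)]
  rw [← lintegral_zero (μ := μ)]
  refine tendsto_lintegral_of_dominated_convergence' f (fun n => hf.indicator (hS n))
    (fun n => Eventually.of_forall fun x => indicator_le_self _ _ x) hfi
    (Eventually.of_forall fun x => ?_)
  obtain ⟨N, hN⟩ := exists_nat_gt (g x)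
  refine tendsto_const_nhds.congr' ?_
  filter_upwards [eventually_ge_atTop N] with n hn
  have : (N : ℝ) ≤ n := by exact_mod_cast hn
  rw [indicator_of_notMem]
  simp only [mem_ofPred_eq, not_lt]
  linarith

section Mollification

variable {d : ℕ} {ν : EuclideanSpace ℝ (Fin d) → ℝ≥0} {Ω : Set (EuclideanSpace ℝ (Fin d))}
  {w : EuclideanSpace ℝ (Fin d) → ℝ≥0∞} {u v : EuclideanSpace ℝ (Fin d) → ℝ}

theorem integral_translate_sub {ρ : Measure (EuclideanSpace ℝ (Fin d))} [IsProbabilityMeasure ρ]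
    (hi : ∀ x, Integrable (fun t => v (x - t)) ρ) (x) :
    (∫ t, v (x - t) ∂ρ) - v x = ∫ t, (v (x - t) - v x) ∂ρ := by
  rw [integral_sub (hi x) (integrable_const _)]
  simp

/-- Since `ρ` has mass one, the error is itself an average of translation errors. Jensen's
inequality at each pair of points and Tonelli conclude. -/
theorem jumpEnergy_average_sub_le (hν : Measurable ν) (hv : Measurable v)
    {ρ : Measure (EuclideanSpace ℝ (Fin d))} [IsProbabilityMeasure ρ]
    (hi : ∀ x, Integrable (fun t => v (x - t)) ρ) :
    jumpEnergy ν Ω (fun x => (∫ t, v (x - t) ∂ρ) - v x) ≤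
      ∫⁻ t, jumpEnergy ν Ω (fun x => v (x - t) - v x) ∂ρ := by
  unfold jumpEnergy
  rw [lintegral_lintegral_swap]
  · refine lintegral_mono fun p => ?_
    dsimp only
    have hi' : ∀ x, Integrable (fun t => v (x - t) - v x) ρ :=
      fun x => (hi x).sub (integrable_const _)
    rw [lintegral_mul_const' _ _ ENNReal.coe_ne_top, integral_translate_sub hi,
      integral_translate_sub hi, ← integral_sub (hi' _) (hi' _)]
    gcongr
    exact ofReal_integral_sq_le ((hi' _).sub (hi' _)).aestronglyMeasurable
  · exact Measurable.aemeasurable (by fun_prop)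

theorem lintegralSq_average_sub_le (m : Measure (EuclideanSpace ℝ (Fin d))) [SFinite m]
    (hv : Measurable v)
    {ρ : Measure (EuclideanSpace ℝ (Fin d))} [IsProbabilityMeasure ρ]
    (hi : ∀ x, Integrable (fun t => v (x - t)) ρ) :
    lintegralSq m (fun x => (∫ t, v (x - t) ∂ρ) - v x) ≤
      ∫⁻ t, lintegralSq m (fun x => v (x - t) - v x) ∂ρ := by
  unfold lintegralSq
  rw [lintegral_lintegral_swap]
  · refine lintegral_mono fun p => ?_
    dsimp only
    rw [integral_translate_sub hi]
    exact ofReal_integral_sq_le ((hi p).sub (integrable_const _)).aestronglyMeasurable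
  · exact Measurable.aemeasurable (by fun_prop)

/-- The square root of the energy density, extended by zero off `Ω × ℝᵈ`. -/
noncomputable def jumpDensity (ν : EuclideanSpace ℝ (Fin d) → ℝ≥0)
    (Ω : Set (EuclideanSpace ℝ (Fin d))) (v : EuclideanSpace ℝ (Fin d) → ℝ)
    (p : EuclideanSpace ℝ (Fin d) × EuclideanSpace ℝ (Fin d)) : ℝ :=
  Ω.indicator (fun _ => 1) p.1 * ((v p.1 - v p.2) * √(ν (p.1 - p.2)))

/-- The squared norm is exactly the jump energy. A diagonal shift leaves `p.1 - p.2` fixed, so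
translating this function only translates `v` and the indicator. -/
theorem memLp_jumpDensity (hν : Measurable ν) (hΩ : MeasurableSet Ω) (hv : Measurable v)
    (h : jumpEnergy ν Ω v < ∞) :
    MemLp (jumpDensity ν Ω v) 2 (volume.prod volume) := by
  have hmeas : Measurable (jumpDensity ν Ω v) := by
    have : Measurable fun p : EuclideanSpace ℝ (Fin d) × EuclideanSpace ℝ (Fin d) =>
      Ω.indicator (fun _ => (1 : ℝ)) p.1 := (measurable_const.indicator hΩ).comp measurable_fst
    unfold jumpDensity
    fun_prop
  rw [memLp_two_iff_lintegralSq_lt_top hmeas.aemeasurable]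
  refine lt_of_eq_of_lt ?_ h
  rw [jumpEnergy, ← restrict_prod_univ, ← lintegral_indicator (hΩ.prod MeasurableSet.univ)]
  refine lintegral_congr fun p => ?_
  by_cases hp : p.1 ∈ Ω
  · rw [indicator_of_mem (by exact ⟨hp, mem_univ _⟩), jumpDensity, indicator_of_mem hp, one_mul,
      mul_pow, Real.sq_sqrt (NNReal.coe_nonneg _), ENNReal.ofReal_mul (sq_nonneg _),
      ENNReal.ofReal_coe_nnreal]
  · rw [indicator_of_notMem (fun h => hp h.1), jumpDensity, indicator_of_notMem hp]
    simp

/-- Near `z` the shift keeps `x` in `Ω`, so both indicators in the translated density equal one and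
the integrands coincide. Away from `z` only `y` can see `v`; then `x` and `y` are separated, `ν` is
bounded, and an `L²` error remains. -/
theorem exists_jumpEnergy_translate_sub_le [NeZero d] (hun : IsUnimodal ν)
    (hΩo : IsOpen Ω) {z : EuclideanSpace ℝ (Fin d)} {r : ℝ} (hr : 0 < r)
    (hv : Measurable v) (hvs : ∀ x, r / 2 ≤ ‖x - z‖ → v x = 0) :
    ∃ C : ℝ≥0, ∀ τ, ‖τ‖ < r / 8 → (∀ x ∈ Ω ∩ Metric.ball z r, x + τ ∈ Ω) →
      jumpEnergy ν Ω (fun x => v (x + τ) - v x) ≤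
        lintegralSq (volume.prod volume)
          (fun p => jumpDensity ν Ω v (p + (τ, τ)) - jumpDensity ν Ω v p) +
        C * volume Ω * lintegralSq volume (fun x => v (x + τ) - v x) := by
  obtain ⟨C, -, hC⟩ := hun.exists_le_of_le_norm (r := r / 8) (by positivity)
  refine ⟨C, fun τ hτ hshift => ?_⟩
  have hsnd : ∫⁻ p, C * ENNReal.ofReal ((v (p.2 + τ) - v p.2) ^ 2)
      ∂((volume.restrict Ω).prod (volume : Measure (EuclideanSpace ℝ (Fin d)))) =
      C * volume Ω * lintegralSq volume (fun x => v (x + τ) - v x) := by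
    rw [lintegral_prod _ (Measurable.aemeasurable (by fun_prop))]
    dsimp only
    rw [lintegral_const, lintegral_const_mul' _ _ ENNReal.coe_ne_top, Measure.restrict_apply_univ, lintegralSq]
    ring
  rw [← hsnd]
  have hfst : ∫⁻ p, ENNReal.ofReal ((jumpDensity ν Ω v (p + (τ, τ)) - jumpDensity ν Ω v p) ^ 2)
      ∂((volume.restrict Ω).prod volume) ≤ lintegralSq (volume.prod volume)
          (fun p => jumpDensity ν Ω v (p + (τ, τ)) - jumpDensity ν Ω v p) := by
    rw [← restrict_prod_univ]
    exact setLIntegral_le_lintegral _ _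
  refine le_trans ?_ (add_le_add_left hfst _)
  rw [← lintegral_add_right _ (by fun_prop), jumpEnergy, ← restrict_prod_univ]
  refine setLIntegral_mono_ae' (hΩo.measurableSet.prod MeasurableSet.univ)
    (Eventually.of_forall fun p hp => ?_)
  obtain ⟨x, y⟩ := p
  have hx : x ∈ Ω := hp.1
  dsimp only
  by_cases hxz : ‖x - z‖ < 3 * r / 4
  · refine le_trans (le_of_eq ?_) le_self_add
    have hxτ : x + τ ∈ Ω := hshift x ⟨hx, by rw [mem_ball_iff_norm]; linarith⟩
    simp only [jumpDensity, Prod.mk_add_mk, indicator_of_mem hx, indicator_of_mem hxτ, one_mul,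
      add_sub_add_right_eq_sub]
    rw [← sub_mul, mul_pow, Real.sq_sqrt (NNReal.coe_nonneg _), ENNReal.ofReal_mul (sq_nonneg _),
      ENNReal.ofReal_coe_nnreal]
    ring_nf
  · refine le_trans ?_ le_add_self
    rw [not_lt] at hxz
    have hτx : ‖x - z‖ ≤ ‖x + τ - z‖ + ‖τ‖ := by
      calc ‖x - z‖ = ‖(x + τ - z) - τ‖ := by congr 1; abel
        _ ≤ _ := norm_sub_le _ _
    rw [hvs x (by linarith), hvs (x + τ) (by linarith)]
    by_cases hy : v (y + τ) = 0 ∧ v y = 0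
    · simp [hy.1, hy.2]
    -- Here `5 r / 8 = r / 2 + r / 8`, support radius plus shift; subtracting it from `3 r / 4`
    -- leaves the separation `r / 8`.
    · have hyz : ‖y - z‖ < 5 * r / 8 := by
        by_contra hcon
        rw [not_lt] at hcon
        have hτy : ‖y - z‖ ≤ ‖y + τ - z‖ + ‖τ‖ := by
          calc ‖y - z‖ = ‖(y + τ - z) - τ‖ := by congr 1; abel
            _ ≤ _ := norm_sub_le _ _
        exact hy ⟨hvs _ (by linarith), hvs _ (by linarith)⟩
      have hxy : r / 8 ≤ ‖x - y‖ := by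
        have : ‖x - z‖ ≤ ‖x - y‖ + ‖y - z‖ := norm_sub_le_norm_sub_add_norm_sub x y z
        linarith
      rw [mul_comm, sub_self, zero_sub, neg_sq]
      gcongr
      exact hC _ hxy

end Mollification

/-! ### Approximation of localized functions -/

/-- `u` can be approximated, in the energy norm with weight `w`, by continuous functions with
compact support. -/
def IsApproximable {d : ℕ} (ν : EuclideanSpace ℝ (Fin d) → ℝ≥0)
    (Ω : Set (EuclideanSpace ℝ (Fin d))) (m : Measure (EuclideanSpace ℝ (Fin d)))
    (u : EuclideanSpace ℝ (Fin d) → ℝ) : Prop :=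
  ∀ ε : ℝ≥0∞, ε ≠ 0 → ∃ φ ∈ energySpace ν Ω, Continuous φ ∧ HasCompactSupport φ ∧
    jumpEnergy ν Ω (φ - u) + lintegralSq m (φ - u) ≤ ε

section Localization

variable {d : ℕ} {ν : EuclideanSpace ℝ (Fin d) → ℝ≥0} {Ω : Set (EuclideanSpace ℝ (Fin d))}
  {w : EuclideanSpace ℝ (Fin d) → ℝ≥0∞} {u v : EuclideanSpace ℝ (Fin d) → ℝ}

theorem tendsto_jumpDensity_translate (hν : Measurable ν) (hΩ : MeasurableSet Ω)
    (hv : Measurable v) (h : jumpEnergy ν Ω v < ∞) :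
    Tendsto (fun τ : EuclideanSpace ℝ (Fin d) => lintegralSq (volume.prod volume)
      (fun p => jumpDensity ν Ω v (p + (τ, τ)) - jumpDensity ν Ω v p)) (𝓝 0) (𝓝 0) := by
  have h1 := tendsto_lintegralSq_translate _ (memLp_jumpDensity hν hΩ hv h)
  have h2 : Tendsto (fun τ : EuclideanSpace ℝ (Fin d) => (τ, τ)) (𝓝 0) (𝓝 0) :=
    Continuous.tendsto' (by fun_prop) _ _ rfl
  exact h1.comp h2

/-- The probability measure whose density is a normalized bump function. -/
noncomputable def bumpMeasure {c : EuclideanSpace ℝ (Fin d)} (f : ContDiffBump c) :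
    Measure (EuclideanSpace ℝ (Fin d)) :=
  volume.withDensity fun t => ENNReal.ofReal (f.normed volume t)

instance isProbabilityMeasure_bumpMeasure {c : EuclideanSpace ℝ (Fin d)} (f : ContDiffBump c) :
    IsProbabilityMeasure (bumpMeasure f) := by
  refine ⟨?_⟩
  rw [bumpMeasure, withDensity_apply _ MeasurableSet.univ, Measure.restrict_univ,
    ← ofReal_integral_eq_lintegral_ofReal f.integrable_normed
      (Eventually.of_forall f.nonneg_normed), f.integral_normed, ENNReal.ofReal_one]

theorem convolution_normed_eq_integral {c : EuclideanSpace ℝ (Fin d)} (f : ContDiffBump c)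
    (v : EuclideanSpace ℝ (Fin d) → ℝ) (x) :
    (convolution (f.normed volume) v (ContinuousLinearMap.lsmul ℝ ℝ) volume) x =
      ∫ t, v (x - t) ∂bumpMeasure f := by
  rw [bumpMeasure, integral_withDensity_eq_integral_toReal_smul
    (f.continuous_normed.measurable.ennreal_ofReal) (Eventually.of_forall fun _ =>
      ENNReal.ofReal_lt_top), convolution]
  refine integral_congr_ae (Eventually.of_forall fun t => ?_)
  simp [ENNReal.toReal_ofReal (f.nonneg_normed t)]

theorem ae_bumpMeasure_mem_ball {c : EuclideanSpace ℝ (Fin d)} (f : ContDiffBump c) :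
    ∀ᵐ t ∂bumpMeasure f, t ∈ Metric.ball c f.rOut := by
  rw [bumpMeasure, ae_withDensity_iff f.continuous_normed.measurable.ennreal_ofReal]
  refine Eventually.of_forall fun t ht => ?_
  rw [← f.support_normed_eq (μ := volume)]
  intro h0
  simp [h0] at ht

/-- The bounded kernel makes the measure at most a multiple of Lebesgue, and on a probability space
`L²` lies in `L¹`. -/
theorem integrable_translate_bumpMeasure {c : EuclideanSpace ℝ (Fin d)} (f : ContDiffBump c)
    (hv : MemLp v 2 volume) (x) : Integrable (fun t => v (x - t)) (bumpMeasure f) := by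
  obtain ⟨C, hC⟩ := (f.hasCompactSupport_normed (μ := volume)).exists_bound_of_continuous
    f.continuous_normed
  have hle : bumpMeasure f ≤ ENNReal.ofReal C • volume := by
    rw [bumpMeasure, ← withDensity_const]
    refine withDensity_mono (Eventually.of_forall fun t => ENNReal.ofReal_le_ofReal ?_)
    exact (le_abs_self _).trans (hC t)
  have h1 : MemLp (fun t => v (x - t)) 2 volume :=
    hv.comp_measurePreserving (Measure.measurePreserving_sub_left volume x)
  exact ((h1.smul_measure ENNReal.ofReal_ne_top).mono_measure hle).integrable one_le_two

/-- The mollifier is concentrated on a ball of inward shifts instead of a ball around the origin, so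
every translate in the average obeys the shift estimate. -/
theorem isApproximable_of_localized [NeZero d] (hν : IsLevyDensity ν) (hun : IsUnimodal ν)
    (hΩo : IsOpen Ω) (hΩ : Bornology.IsBounded Ω) (hw : IsAdmissibleWeight ν Ω w)
    {z : EuclideanSpace ℝ (Fin d)} {r : ℝ} (hr : 0 < r) (hshift : HasInwardShifts Ω z r)
    (hv : Measurable v) (hvV : v ∈ energySpace ν Ω) (hvs : ∀ x, r / 2 ≤ ‖x - z‖ → v x = 0) :
    IsApproximable ν Ω (volume.withDensity w) v := by
  have hm := hν.measurable
  have hvE := ((mem_energySpace_iff hm).1 hvV).2.2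
  have hv2 : MemLp v 2 volume := by
    rw [memLp_two_iff_lintegralSq_lt_top hv.aemeasurable]
    obtain ⟨C, hC⟩ := hw.exists_lintegralSq_restrict_le (S := Metric.ball z r)
      measurableSet_ball Metric.isBounded_ball
    refine lt_of_le_of_lt (le_of_eq ?_) ((hC v hv.aemeasurable).trans_lt
      (ENNReal.mul_lt_top ENNReal.coe_lt_top (hw.lintegralSq_lt_top hν hun hvV)))
    rw [lintegralSq, lintegralSq, ← lintegral_indicator measurableSet_ball]
    refine lintegral_congr fun x => ?_
    by_cases hx : x ∈ Metric.ball z r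
    · rw [indicator_of_mem hx]
    · rw [indicator_of_notMem hx, hvs x, zero_pow two_ne_zero, ENNReal.ofReal_zero]
      rw [mem_ball_iff_norm, not_lt] at hx
      linarith
  have hvc : HasCompactSupport v := by
    refine HasCompactSupport.of_support_subset_isCompact (isCompact_closedBall z (r / 2))
      fun x hx => ?_
    rw [mem_closedBall_iff_norm]
    by_contra hcon
    exact hx (hvs x (not_le.1 hcon).le)
  obtain ⟨C₁, hC₁⟩ := exists_jumpEnergy_translate_sub_le hun hΩo hr hv hvs
  obtain ⟨C₂, hC₂⟩ := hw.exists_lintegralSq_le_volume hΩ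
  intro ε' hε'
  -- A finite tolerance lets the final bound also show that `φ - v`, hence `φ`, has finite energy.
  set ε := min ε' 1
  have hε : ε ≠ 0 := (lt_min (pos_iff_ne_zero.2 hε') one_pos).ne'
  set H : EuclideanSpace ℝ (Fin d) → ℝ≥0∞ := fun τ =>
    lintegralSq (volume.prod volume)
      (fun p => jumpDensity ν Ω v (p + (τ, τ)) - jumpDensity ν Ω v p) +
    (C₁ * volume Ω + C₂) * lintegralSq volume (fun x => v (x + τ) - v x) with hH
  have hHt : Tendsto H (𝓝 0) (𝓝 0) := by
    have h1 := tendsto_jumpDensity_translate hm hΩo.measurableSet hv hvE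
    have h2 := ENNReal.Tendsto.const_mul (a := C₁ * volume Ω + C₂)
      (tendsto_lintegralSq_translate volume hv2) (Or.inr (ENNReal.add_ne_top.2
        ⟨ENNReal.mul_ne_top ENNReal.coe_ne_top hΩ.measure_lt_top.ne, ENNReal.coe_ne_top⟩))
    have h3 := h1.add h2
    rwa [mul_zero, add_zero] at h3
  obtain ⟨δ, hδ, hδH⟩ := Metric.eventually_nhds_iff_ball.1
    (hHt.eventually (eventually_le_nhds (pos_iff_ne_zero.2 hε)))
  obtain ⟨a, s, hs, has, hsh⟩ := hshift (min δ (r / 8)) (by positivity)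
  have hH' : ∀ τ ∈ Metric.ball a s, jumpEnergy ν Ω (fun x => v (x + τ) - v x) +
      lintegralSq (volume.withDensity w) (fun x => v (x + τ) - v x) ≤ ε := by
    intro τ hτ
    have hτ' := mem_ball_zero_iff.1 (has hτ)
    refine le_trans ?_ (hδH τ (mem_ball_zero_iff.2 (hτ'.trans_le (min_le_left _ _))))
    rw [hH]
    dsimp only
    rw [add_mul, ← add_assoc]
    exact add_le_add (hC₁ τ (hτ'.trans_le (min_le_right _ _)) (hsh τ hτ))
      (hC₂ _ (by fun_prop))
  -- Centred at `-a` because convolution evaluates `v` at `x - t`: the shift `-t` then runs through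
  -- the ball around `a`.
  let f : ContDiffBump (-a) := ⟨s / 2, s, by positivity, by linarith⟩
  set φ := convolution (f.normed volume) v (ContinuousLinearMap.lsmul ℝ ℝ) volume with hφ
  have hφeq : φ - v = fun x => (∫ t, v (x - t) ∂bumpMeasure f) - v x := by
    funext x
    rw [Pi.sub_apply, hφ, convolution_normed_eq_integral]
  have hφc : Continuous φ := f.hasCompactSupport_normed.continuous_convolution_left _
    f.continuous_normed (hv2.locallyIntegrable one_le_two)
  have hφs : HasCompactSupport φ := HasCompactSupport.convolution _ f.hasCompactSupport_normed hvc
  have hi := integrable_translate_bumpMeasure f hv2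
  have hbound : jumpEnergy ν Ω (φ - v) + lintegralSq (volume.withDensity w) (φ - v) ≤ ε := by
    rw [hφeq]
    calc _ ≤ (∫⁻ t, jumpEnergy ν Ω (fun x => v (x - t) - v x) ∂bumpMeasure f) +
          ∫⁻ t, lintegralSq (volume.withDensity w) (fun x => v (x - t) - v x) ∂bumpMeasure f :=
          add_le_add (jumpEnergy_average_sub_le hm hv hi) (lintegralSq_average_sub_le _ hv hi)
      _ ≤ ∫⁻ t, (jumpEnergy ν Ω (fun x => v (x - t) - v x) +
            lintegralSq (volume.withDensity w) (fun x => v (x - t) - v x)) ∂bumpMeasure f :=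
          le_lintegral_add _ _
      _ ≤ ∫⁻ _, ε ∂bumpMeasure f := by
          refine lintegral_mono_ae ?_
          filter_upwards [ae_bumpMeasure_mem_ball f] with t ht
          have ht' : -t ∈ Metric.ball a s := by
            have : dist t (-a) < s := ht
            rwa [Metric.mem_ball, ← dist_neg_neg, neg_neg]
          simpa only [← sub_eq_add_neg] using hH' (-t) ht'
      _ = ε := by simp
  have hε1 : ε < ∞ := (min_le_right _ _).trans_lt ENNReal.one_lt_top
  have hdm : AEMeasurable (φ - v) volume := hφc.measurable.aemeasurable.sub hv.aemeasurable
  have hdV : φ - v ∈ energySpace ν Ω := by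
    obtain ⟨C, hC⟩ := hw.exists_lintegralSq_restrict_le hΩo.measurableSet hΩ
    rw [mem_energySpace_iff hm]
    exact ⟨hdm, (hC _ hdm).trans_lt (ENNReal.mul_lt_top ENNReal.coe_lt_top
      ((le_add_self.trans hbound).trans_lt hε1)), (le_self_add.trans hbound).trans_lt hε1⟩
  refine ⟨φ, ?_, hφc, hφs, hbound.trans (min_le_left _ _)⟩
  have := energySpace_add_mem hm hdV hvV
  rwa [sub_add_cancel] at this

theorem IsApproximable.add (hν : IsLevyDensity ν) {m : Measure (EuclideanSpace ℝ (Fin d))}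
    (hmv : m ≪ volume) (hu : IsApproximable ν Ω m u) (hv : IsApproximable ν Ω m v)
    (hum : AEMeasurable u volume) : IsApproximable ν Ω m (u + v) := by
  intro ε hε
  have hε4 : ε / 4 ≠ 0 := (ENNReal.div_pos hε (by simp)).ne'
  obtain ⟨φ, hφV, hφc, hφs, hφ⟩ := hu (ε / 4) hε4
  obtain ⟨ψ, hψV, hψc, hψs, hψ⟩ := hv (ε / 4) hε4
  have hdm : AEMeasurable (φ - u) volume := hφc.measurable.aemeasurable.sub hum
  refine ⟨φ + ψ, energySpace_add_mem hν.measurable hφV hψV, hφc.add hψc, hφs.add hψs, ?_⟩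
  rw [add_sub_add_comm]
  calc _ ≤ (2 * jumpEnergy ν Ω (φ - u) + 2 * jumpEnergy ν Ω (ψ - v)) +
        (2 * lintegralSq m (φ - u) + 2 * lintegralSq m (ψ - v)) :=
        add_le_add (jumpEnergy_add_le hν.measurable hdm) (lintegralSq_add_le (hdm.mono_ac hmv))
    _ = 2 * (jumpEnergy ν Ω (φ - u) + lintegralSq m (φ - u)) +
        2 * (jumpEnergy ν Ω (ψ - v) + lintegralSq m (ψ - v)) := by ring
    _ ≤ 2 * (ε / 4) + 2 * (ε / 4) := by gcongr
    _ = 4 * (ε / 4) := by ring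
    _ = ε := ENNReal.mul_div_cancel (by simp) (by simp)

theorem isApproximable_zero (hν : IsLevyDensity ν) (m : Measure (EuclideanSpace ℝ (Fin d))) :
    IsApproximable ν Ω m 0 := fun ε _ =>
  ⟨0, zero_mem_energySpace hν, continuous_zero, HasCompactSupport.zero,
    by simp [jumpEnergy, lintegralSq]⟩

/-- Compactness reduces the claim to small balls, where a cutoff removes `u`. The domination of the
remainder by `u` keeps zeros created on one set when the next is treated, and serves the tail
estimate. -/
theorem exists_isApproximable_add_of_isCompact [NeZero d] (hν : IsLevyDensity ν)
    (hun : IsUnimodal ν) (hΩo : IsOpen Ω) (hΩ : Bornology.IsBounded Ω)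
    (hΩl : HasLipschitzBoundary Ω) (hw : IsAdmissibleWeight ν Ω w)
    {S : Set (EuclideanSpace ℝ (Fin d))} (hS : IsCompact S) :
    ∀ u ∈ energySpace ν Ω, Measurable u → ∃ u₁ u₂ : EuclideanSpace ℝ (Fin d) → ℝ,
      u = u₁ + u₂ ∧ Measurable u₁ ∧ IsApproximable ν Ω (volume.withDensity w) u₁ ∧
      u₂ ∈ energySpace ν Ω ∧ Measurable u₂ ∧ (∀ x ∈ S, u₂ x = 0) ∧ ∀ x, |u₂ x| ≤ |u x| := by
  refine hS.induction_on ?_ ?_ ?_ ?_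
  · intro u hu hum
    exact ⟨0, u, (zero_add u).symm, measurable_const, isApproximable_zero hν _, hu, hum, by simp,
      fun _ => le_rfl⟩
  · intro s t hst ht u hu hum
    obtain ⟨u₁, u₂, h1, h2, h3, h4, h5, h6, h7⟩ := ht u hu hum
    exact ⟨u₁, u₂, h1, h2, h3, h4, h5, fun x hx => h6 x (hst hx), h7⟩
  · intro s t hs ht u hu hum
    obtain ⟨u₁, u₂, h1, h2, h3, h4, h5, h6, h7⟩ := hs u hu hum
    obtain ⟨v₁, v₂, k1, k2, k3, k4, k5, k6, k7⟩ := ht u₂ h4 h5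
    refine ⟨u₁ + v₁, v₂, by rw [add_assoc, ← k1, h1], h2.add k2,
      h3.add hν (withDensity_absolutelyContinuous _ _) k3 h2.aemeasurable, k4, k5, ?_,
      fun x => (k7 x).trans (h7 x)⟩
    rintro x (hx | hx)
    · have := k7 x
      rw [h6 x hx, abs_zero] at this
      exact abs_nonpos_iff.1 this
    · exact k6 x hx
  · intro z _
    obtain ⟨r, hr, hshift⟩ := hΩl.exists_hasInwardShifts hΩo z
    -- One on the ball being cleared, and zero from radius `r / 2` on, as
    -- `isApproximable_of_localized` requires.
    let χ : ContDiffBump z := ⟨r / 4, r / 2, by positivity, by linarith⟩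
    refine ⟨Metric.ball z (r / 4), mem_nhdsWithin_of_mem_nhds (Metric.ball_mem_nhds z (by positivity)),
      fun u hu hum => ?_⟩
    have hχc : Continuous χ := χ.continuous
    obtain ⟨L, hL⟩ := (χ.contDiff (n := 1)).lipschitzWith_of_hasCompactSupport
      χ.hasCompactSupport one_ne_zero
    have hχV : (fun x => χ x * u x) ∈ energySpace ν Ω :=
      energySpace_mul_mem hν (M := 1) (fun x => by
        rw [abs_of_nonneg χ.nonneg]; exact χ.le_one) hL hu
    have hχm : Measurable fun x => χ x * u x := hχc.measurable.mul hum
    refine ⟨fun x => χ x * u x, u - fun x => χ x * u x, by simp, hχm, ?_,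
      energySpace_sub_mem hν.measurable hu hχV, hum.sub hχm, fun x hx => ?_, fun x => ?_⟩
    · refine isApproximable_of_localized hν hun hΩo hΩ hw hr hshift hχm hχV fun x hx => ?_
      rw [χ.zero_of_le_dist (by rw [dist_eq_norm]; exact hx), zero_mul]
    · rw [Pi.sub_apply, χ.one_of_mem_closedBall (Metric.ball_subset_closedBall hx), one_mul,
        sub_self]
    · have h0 := χ.nonneg (x := x)
      have h1 := χ.le_one (x := x)
      have e : (u - fun x => χ x * u x) x = (1 - χ x) * u x := by simp only [Pi.sub_apply]; ring
      rw [e, abs_mul, abs_of_nonneg (by linarith : 0 ≤ 1 - χ x)]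
      exact mul_le_of_le_one_left (abs_nonneg _) (by linarith)

/-! ### Tails, and density of the core -/

/-- One radius serves all `v` dominated by `u`, so it can be fixed before the remainder is
constructed. -/
theorem exists_tail_le (hν : IsLevyDensity ν) (hun : IsUnimodal ν)
    (hΩo : IsOpen Ω) (hΩ : Bornology.IsBounded Ω) (hw : IsAdmissibleWeight ν Ω w)
    (hu : u ∈ energySpace ν Ω) {ε : ℝ≥0∞} (hε : ε ≠ 0) :
    ∃ ρ : ℝ, ∀ v : EuclideanSpace ℝ (Fin d) → ℝ, (∀ x ∈ Metric.closedBall 0 ρ, v x = 0) →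
      (∀ x, |v x| ≤ |u x|) →
      jumpEnergy ν Ω v + lintegralSq (volume.withDensity w) v ≤ ε := by
  have hm := hν.measurable
  obtain ⟨M, hM⟩ := hΩ.exists_norm_le
  have hu' := (mem_energySpace_iff hm).1 hu
  -- Since `v` will vanish on `Ω`, only `v(y)² ν(x - y)` must be bounded; `F` comes from writing
  -- `u(y) = u(x) - (u(x) - u(y))`.
  set F : EuclideanSpace ℝ (Fin d) × EuclideanSpace ℝ (Fin d) → ℝ≥0∞ := fun p =>
    2 * (ENNReal.ofReal ((u p.1 - u p.2) ^ 2) * (ν (p.1 - p.2) : ℝ≥0∞)) +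
    2 * (ENNReal.ofReal ((u p.1) ^ 2) *
      (ENNReal.ofReal (min 1 (‖p.1 - p.2‖ ^ 2)) * (ν (p.1 - p.2) : ℝ≥0∞))) with hF
  have hjm := (aemeasurable_jump hm hu'.1).mono_ac (restrict_prod_absolutelyContinuous Ω)
  have hlm := aemeasurable_sq_mul_levy (Ω := Ω) hm hu'.1
  have hFm : AEMeasurable F ((volume.restrict Ω).prod volume) :=
    (hjm.const_mul _).add (hlm.const_mul _)
  have hFi : ∫⁻ p, F p ∂((volume.restrict Ω).prod volume) ≠ ∞ := by
    rw [hF, lintegral_add_left' (hjm.const_mul _), lintegral_const_mul' _ _ ENNReal.ofNat_ne_top,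
      lintegral_const_mul' _ _ ENNReal.ofNat_ne_top, lintegral_sq_mul_levy hν hu'.1]
    exact ENNReal.add_ne_top.2 ⟨ENNReal.mul_ne_top (by simp) hu'.2.2.ne,
      ENNReal.mul_ne_top (by simp) (ENNReal.mul_ne_top hu'.2.1.ne hν.levy.ne)⟩
  have ht1 := tendsto_setLIntegral_superlevel hFm hFi (g := fun p => ‖p.2‖) (by fun_prop)
  have ht2 := tendsto_setLIntegral_superlevel
    (aemeasurable_ofReal_sq (hu'.1.mono_ac (withDensity_absolutelyContinuous volume w)))
    (hw.lintegralSq_lt_top hν hun hu).ne (g := fun x => ‖x‖) (by fun_prop)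
  have ht := ht1.add ht2
  rw [add_zero] at ht
  -- With `n ≥ M + 1`, the tail is at distance at least one from `Ω`, where the truncation in `F`
  -- equals `1`.
  obtain ⟨n, hn, hnM⟩ := ((ht.eventually (eventually_le_nhds (pos_iff_ne_zero.2 hε))).and
    (tendsto_natCast_atTop_atTop.eventually_ge_atTop (M + 1))).exists
  refine ⟨n, fun v hv0 hvu => le_trans (add_le_add ?_ ?_) hn⟩
  · have hS : MeasurableSet {p : EuclideanSpace ℝ (Fin d) × EuclideanSpace ℝ (Fin d) |
        (n : ℝ) < ‖p.2‖} := measurableSet_lt measurable_const (by fun_prop)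
    rw [jumpEnergy, ← lintegral_indicator hS, ← restrict_prod_univ]
    refine setLIntegral_mono_ae' (hΩo.measurableSet.prod MeasurableSet.univ)
      (Eventually.of_forall fun p hp => ?_)
    have hxM : ‖p.1‖ ≤ M := hM _ hp.1
    rw [hv0 p.1 (by rw [mem_closedBall_zero_iff]; linarith), zero_sub, neg_sq]
    by_cases hy : (n : ℝ) < ‖p.2‖
    · rw [indicator_of_mem (by exact hy), hF]
      have h1 : 1 ≤ ‖p.1 - p.2‖ := by
        have := norm_sub_norm_le p.2 p.1
        rw [norm_sub_rev] at this
        linarith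
      dsimp only
      rw [min_eq_left (one_le_pow₀ h1), ENNReal.ofReal_one, one_mul, ← mul_assoc, ← mul_assoc,
        ← add_mul]
      gcongr
      calc ENNReal.ofReal ((v p.2) ^ 2) ≤ ENNReal.ofReal ((u p.2) ^ 2) :=
            ENNReal.ofReal_le_ofReal (sq_le_sq.2 (hvu _))
        _ = ENNReal.ofReal ((-(u p.1 - u p.2) + u p.1) ^ 2) := by congr 2; ring
        _ ≤ _ := (ENNReal.ofReal_add_sq_le _ _).trans_eq (by rw [neg_sq])
    · rw [hv0 p.2 (by rw [mem_closedBall_zero_iff]; exact not_lt.1 hy)]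
      simp
  · have hS : MeasurableSet {x : EuclideanSpace ℝ (Fin d) | (n : ℝ) < ‖x‖} :=
      measurableSet_lt measurable_const (by fun_prop)
    rw [lintegralSq, ← lintegral_indicator hS]
    refine lintegral_mono fun x => ?_
    by_cases hx : (n : ℝ) < ‖x‖
    · rw [indicator_of_mem (by exact hx)]
      exact ENNReal.ofReal_le_ofReal (sq_le_sq.2 (hvu _))
    · rw [hv0 x (by rw [mem_closedBall_zero_iff]; exact not_lt.1 hx)]
      simp

theorem exists_core_approx [NeZero d] (hν : IsLevyDensity ν)
    (hun : IsUnimodal ν) (hΩo : IsOpen Ω) (hΩ : Bornology.IsBounded Ω)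
    (hΩl : HasLipschitzBoundary Ω) (hw : IsAdmissibleWeight ν Ω w)
    (hu : u ∈ energySpace ν Ω) {ε : ℝ} (hε : 0 < ε) :
    ∃ φ ∈ energySpace ν Ω, Continuous φ ∧ HasCompactSupport φ ∧
      energyOne (volume.withDensity w) (energyForm ν Ω) (u - φ) < ε := by
  have hm := hν.measurable
  have hac := withDensity_absolutelyContinuous volume w
  -- A Borel version is needed because the mollification estimates assume genuine measurability.
  set u' := hu.1.mk u with hu'
  have huu' : u =ᵐ[volume] u' := hu.1.ae_eq_mk
  have hu'm : Measurable u' := hu.1.measurable_mk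
  have hu'V := mem_energySpace_congr_ae hm huu' hu
  set η : ℝ≥0∞ := ENNReal.ofReal (ε / 8)
  have hη : η ≠ 0 := (ENNReal.ofReal_pos.2 (by positivity)).ne'
  obtain ⟨ρ, hρ⟩ := exists_tail_le hν hun hΩo hΩ hw hu'V hη
  obtain ⟨u₁, u₂, h1, h2, h3, h4, h5, h6, h7⟩ := exists_isApproximable_add_of_isCompact hν hun hΩo
    hΩ hΩl hw (isCompact_closedBall 0 ρ) u' hu'V hu'm
  obtain ⟨φ, hφV, hφc, hφs, hφ⟩ := h3 η hη
  refine ⟨φ, hφV, hφc, hφs, energyOne_lt_of_lt_ofReal hν hun hw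
    (energySpace_sub_mem hm hu hφV) ?_⟩
  have hae : u - φ =ᵐ[volume] u₂ + (-1 : ℝ) • (φ - u₁) := by
    filter_upwards [huu'] with x hx
    have : u' x = u₁ x + u₂ x := congrFun h1 x
    simp only [Pi.sub_apply, Pi.add_apply, Pi.smul_apply, smul_eq_mul, hx, this]
    ring
  rw [jumpEnergy_congr_ae hae, lintegralSq_congr_ae (hac.ae_le hae)]
  calc _ ≤ (2 * jumpEnergy ν Ω u₂ + 2 * jumpEnergy ν Ω ((-1 : ℝ) • (φ - u₁))) +
        (2 * lintegralSq (volume.withDensity w) u₂ +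
          2 * lintegralSq (volume.withDensity w) ((-1 : ℝ) • (φ - u₁))) :=
        add_le_add (jumpEnergy_add_le hm h4.1) (lintegralSq_add_le (h4.1.mono_ac hac))
    _ = 2 * (jumpEnergy ν Ω u₂ + lintegralSq (volume.withDensity w) u₂) +
        2 * (jumpEnergy ν Ω (φ - u₁) + lintegralSq (volume.withDensity w) (φ - u₁)) := by
        rw [jumpEnergy_smul, lintegralSq_smul]
        norm_num
        ring
    _ ≤ 2 * η + 2 * η := by gcongr; exact hρ u₂ h6 h7
    _ = ENNReal.ofReal (ε / 2) := by
        rw [← two_mul, ← mul_assoc, show (2 * 2 : ℝ≥0∞) = ENNReal.ofReal 4 by norm_num,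
          ← ENNReal.ofReal_mul (by norm_num)]
        congr 1; ring
    _ < ENNReal.ofReal ε := (ENNReal.ofReal_lt_ofReal_iff hε).2 (half_lt_self hε)

/-- Full support of `ν` enters only through the lower bound contained in admissibility. -/
theorem isRegularDirichletForm_of_isAdmissibleWeight [NeZero d] (hν : IsLevyDensity ν)
    (hun : IsUnimodal ν) (hΩo : IsOpen Ω) (hΩ : Bornology.IsBounded Ω)
    (hΩl : HasLipschitzBoundary Ω) (hw : IsAdmissibleWeight ν Ω w) :
    IsRegularDirichletForm (volume.withDensity w) (energySpace ν Ω) (energyForm ν Ω) where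
  radon := hw.isFiniteMeasureOnCompacts hΩ
  full_support := hw.isOpenPosMeasure
  isDirichletForm := isDirichletForm_energyForm hν hun hΩo hΩ hw
  core_dense _ hu _ hε := exists_core_approx hν hun hΩo hΩ hΩl hw hu hε
  core_uniform _ hf hc _ hε := exists_smooth_uniform_approx hν hΩ hf hc hε

end Localization

theorem mainTheorem10 {d : ℕ} [NeZero d] (ν : EuclideanSpace ℝ (Fin d) → ℝ≥0)
    (hν : IsLevyDensity ν) (hν_unimodal : IsUnimodal ν) (hν_supp : HasFullSupport ν)
    (Ω : Set (EuclideanSpace ℝ (Fin d))) (hΩ_open : IsOpen Ω)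
    (hΩ_bdd : Bornology.IsBounded Ω) (hΩ_lip : HasLipschitzBoundary Ω) :
    (∀ B : Set (EuclideanSpace ℝ (Fin d)), IsOpen B → B.Nonempty → B ⊆ Ω →
      IsRegularDirichletForm (nuTilde ν B) (energySpace ν Ω) (energyForm ν Ω) ∧
      IsRegularDirichletForm (nuBar ν B) (energySpace ν Ω) (energyForm ν Ω)) ∧
    (∀ R : ℝ, 1 < R → (Metric.ball 0 R ∩ Ω).Nonempty →
      IsRegularDirichletForm (nuStar ν R) (energySpace ν Ω) (energyForm ν Ω)) := by
  refine ⟨fun B hB hne hBΩ => ⟨?_, ?_⟩, fun R hR hne => ?_⟩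
  · exact isRegularDirichletForm_of_isAdmissibleWeight hν hν_unimodal hΩ_open hΩ_bdd hΩ_lip
      (isAdmissibleWeight_nuTilde hν hν_unimodal hν_supp hΩ_bdd hB hne hBΩ)
  · exact isRegularDirichletForm_of_isAdmissibleWeight hν hν_unimodal hΩ_open hΩ_bdd hΩ_lip
      (isAdmissibleWeight_nuBar hν hν_unimodal hν_supp hΩ_bdd hB hne hBΩ)
  · exact isRegularDirichletForm_of_isAdmissibleWeight hν hν_unimodal hΩ_open hΩ_bdd hΩ_lip
      (isAdmissibleWeight_nuStar hν hν_unimodal hν_supp hΩ_open hR hne)
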